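/- Throughout, the empty space is regarded as the sphere of dimension $-1$. For a poset $P$ and $x,y\in P$, the *under set* of $P$ at $x$ is $U_x=\{z\in P : z<x\}$, the *over set* at $x$ is $O_x=\{z\in P : z>x\}$, and the *strict interval* between $x$ and $y$ is $(x,y)=O_x\cap U_y$; all of these are posets with the induced order. The *order complex* of a poset is the simplicial complex whose simplices are its nonempty finite chains. A CW complex is *regular* if the characteristic maps of its cells (defined on closed balls) are embeddings, and a *cell poset* is a poset isomorphic to the set of closed cells of some regular CW complex, ordered by inclusion. A *PL-triangulated manifold* is a simplicial complex that is homeomorphic to a manifold and in which the link of every simplex is homeomorphic to a sphere (of some dimension $\ge -1$); a *PL-triangulated sphere* is a PL-triangulated manifold that is homeomorphic to a sphere. **Theorem.** Let $P$ be a cell poset. The following conditions are equivalent. 1. For every $x\in P$, the order complex of the under set $U_x$ is a PL-triangulated sphere. 2. For all $x,y\in P$, the order complex of the strict interval $(x,y)$ is a PL-triangulated sphere. 3. For all $x,y\in P$, the order complex of the strict interval $(x,y)$ is homeomorphic to a sphere. 4. For every $x\in P$, the over set $O_x$ is a cell poset. -/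

import Mathlib

universe u

namespace PreAbstractSimplicialComplex

variable {V : Type u}

/-- The geometric realization of an abstract simplicial complex, by barycentric coordinates. -/
def Realization (K : PreAbstractSimplicialComplex V) : Type u :=
  {f : V →₀ ℝ // (∀ v, 0 ≤ f v) ∧ f.support ∈ K.faces ∧ (f.sum fun _ r => r) = 1}

/-- The closed simplex of the geometric realization spanned by a set `s` of vertices. -/
def Realization.closedSimplex (K : PreAbstractSimplicialComplex V) (s : Finset V) :
    Set K.Realization :=
  {x | x.1.support ⊆ s}

/-- The Euclidean topology on a closed simplex: pointwise convergence of the barycentric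
coordinates (only the finitely many coordinates in `s` can be nonzero). -/
@[reducible] def Realization.simplexTopology (K : PreAbstractSimplicialComplex V) (s : Finset V) :
    TopologicalSpace (Realization.closedSimplex K s) :=
  TopologicalSpace.induced (fun x v => x.1.1 v) (inferInstance : TopologicalSpace (V → ℝ))

/-- The weak topology: a set is open iff its intersection with each closed simplex is open in that
simplex. -/
instance (K : PreAbstractSimplicialComplex V) : TopologicalSpace K.Realization :=
  ⨆ s : K.faces, TopologicalSpace.coinduced Subtype.val (Realization.simplexTopology K s.1)

/-- The link of a simplex `σ`: the simplices disjoint from `σ` whose union with `σ` is a simplex. -/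
def link (K : PreAbstractSimplicialComplex V) (σ : Finset V) : PreAbstractSimplicialComplex V where
  faces := {τ | τ.Nonempty ∧ ∃ h : Disjoint σ τ, σ.disjUnion τ h ∈ K.faces}
  isRelLowerSet_faces := by
    rintro τ ⟨hτ, hd, hK⟩
    refine ⟨hτ, fun ρ hρ hne => ⟨hne, hd.mono_right hρ, ?_⟩⟩
    refine (K.isRelLowerSet_faces hK).2 ?_ ?_
    · intro v hv
      rw [Finset.mem_disjUnion] at hv ⊢
      exact hv.imp id fun h => hρ h
    · obtain ⟨v, hv⟩ := hne
      exact ⟨v, Finset.mem_disjUnion.2 (Or.inr hv)⟩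

end PreAbstractSimplicialComplex

/-- The order complex of a poset: the abstract simplicial complex of its nonempty finite chains. -/
def orderComplex (P : Type u) [PartialOrder P] : PreAbstractSimplicialComplex P where
  faces := {s | s.Nonempty ∧ IsChain (· ≤ ·) (s : Set P)}
  isRelLowerSet_faces := fun _ hs =>
    ⟨hs.1, fun _ ht hne => ⟨hne, hs.2.mono (Finset.coe_subset.2 ht)⟩⟩

/-- Being homeomorphic to a sphere of dimension `n - 1` for some natural number `n`; for `n = 0`
this is the empty space, the sphere of dimension `-1`. -/
def IsHomeomorphicToSphere (X : Type u) [TopologicalSpace X] : Prop :=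
  ∃ n : ℕ, Nonempty (X ≃ₜ Metric.sphere (0 : EuclideanSpace ℝ (Fin n)) 1)

/-- Topological manifolds (without boundary): Hausdorff, second countable, and locally Euclidean of
some dimension. -/
def IsTopologicalManifold (X : Type u) [TopologicalSpace X] : Prop :=
  T2Space X ∧ SecondCountableTopology X ∧
    ∃ d : ℕ, Nonempty (ChartedSpace (EuclideanSpace ℝ (Fin d)) X)

/-- PL-triangulated manifolds: simplicial complexes homeomorphic to a manifold in which the link of
every simplex is homeomorphic to a sphere. -/
def IsPLTriangulatedManifold {V : Type u} (K : PreAbstractSimplicialComplex V) : Prop :=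
  IsTopologicalManifold K.Realization ∧
    ∀ σ ∈ K.faces, IsHomeomorphicToSphere (K.link σ).Realization

/-- PL-triangulated spheres: PL-triangulated manifolds homeomorphic to a sphere. -/
def IsPLTriangulatedSphere {V : Type u} (K : PreAbstractSimplicialComplex V) : Prop :=
  IsPLTriangulatedManifold K ∧ IsHomeomorphicToSphere K.Realization

/-- A CW complex structure on `X` is regular if the characteristic maps of its cells, defined on the
closed balls, are embeddings. -/
def IsRegularCW (X : Type u) [TopologicalSpace X]
    [Topology.CWComplex (Set.univ : Set X)] : Prop :=
  ∀ (n : ℕ) (i : Topology.RelCWComplex.cell (Set.univ : Set X) n),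
    Topology.IsEmbedding
      ((Metric.closedBall (0 : Fin n → ℝ) 1).domRestrict (Topology.RelCWComplex.map n i))

/-- The set of (closed) cells of a CW complex; as a set of subsets of `X` it is ordered by
inclusion. -/
def cwCells (X : Type u) [TopologicalSpace X] [Topology.CWComplex (Set.univ : Set X)] :
    Set (Set X) :=
  {c | ∃ (n : ℕ) (i : Topology.RelCWComplex.cell (Set.univ : Set X) n),
    c = Topology.RelCWComplex.closedCell n i}

/-- Cell posets: posets isomorphic to the poset of cells of a (Hausdorff) regular CW complex,
ordered by inclusion. -/
def IsCellPoset (P : Type u) [PartialOrder P] : Prop :=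
  ∃ (X : Type u) (_ : TopologicalSpace X) (_ : T2Space X)
    (_ : Topology.CWComplex (Set.univ : Set X)),
    IsRegularCW X ∧ Nonempty (P ≃o cwCells X)

/-!
Everything rests on two facts about a poset `Q` and the order complexes of its under sets.

* In a cell poset every under set `Iio q` is finite and its order complex is a sphere
  (`IsCellPoset.isHomeomorphicToSphere_Iio`). The essential point is that the boundary of a cell of
  a regular CW complex is a union of cells (`openCell_subset_cellFrontier`). It follows from
  invariance of domain, applied in the boundary sphere of the cell; invariance of domain in turn is
  derived from Brouwer's fixed point theorem, and that from the impossibility of a smooth retraction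
  of a ball onto its boundary sphere. Given the cells, coning from the centres of the cells by
  recursion on the largest element of a chain parametrizes the boundary sphere of a cell by the
  chains of smaller cells (`RegularCells.param`).
* Conversely, if all under sets `Iio q` are finite and their order complexes are spheres, then `Q`
  is a cell poset (`isCellPoset_of_isHomeomorphicToSphere_Iio`): the space is the geometric
  realization of the order complex of `Q`, and the closed cell of `q` is the subcomplex of the
  chains in `Iic q`, a cone over the sphere given by `Iio q`, hence a ball.

Since the under set of `Ioi x` at `y` is the interval `Ioo x y`, the two facts together say that
`Ioi x` is a cell poset if and only if all intervals `Ioo x y` are spheres.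

The link of a chain `σ` in the order complex of `S` is the order complex of the set `linkSet S σ` of
elements of `S` comparable to and distinct from the elements of `σ` (`nonempty_homeomorph_link`).
For `S = Iio x` this set is the ordinal sum of the under set of `min σ`, the intervals between
consecutive elements of `σ`, and the interval between `max σ` and `x`. An ordinal sum of spheres is
a sphere, because its order complex is a join (`isHomeomorphicToSphere_orderComplex_union`); so if
all intervals are spheres, all links are. Conversely, if `σ` is a maximal chain among the elements
`≤ x`, containing `x`, then `linkSet (Iio y) σ` is `Ioo x y`, so that intervals and their links are
links in under sets.
-/

/-! ### Brouwer's fixed point theorem -/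

section Brouwer

open MeasureTheory Metric Set Polynomial

variable {E : Type*} [NormedAddCommGroup E] [InnerProductSpace ℝ E] [FiniteDimensional ℝ E]

/-- `det (1 + t A)` is a polynomial in `t` of degree at most the dimension. -/
lemma exists_polynomial_eval_eq_det_one_add_smul (A : E →L[ℝ] E) :
    ∃ p : ℝ[X], p.natDegree ≤ Module.finrank ℝ E ∧
      ∀ t : ℝ, p.eval t = (1 + t • A).det := by
  let b := Module.finBasis ℝ E
  let M := LinearMap.toMatrix b b (A : E →ₗ[ℝ] E)
  refine ⟨Matrix.det ((X : ℝ[X]) • M.map C + (1 : Matrix _ _ ℝ).map C), ?_, ?_⟩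
  · simpa using natDegree_det_X_add_C_le M 1
  · intro t
    rw [← coe_evalRingHom, RingHom.map_det, ContinuousLinearMap.det, ← LinearMap.det_toMatrix b]
    congr 1
    have : ((1 + t • A : E →L[ℝ] E) : E →ₗ[ℝ] E) = 1 + t • A.toLinearMap := rfl
    have h1 : LinearMap.toMatrix b b (1 + t • A.toLinearMap) = 1 + t • M := by
      rw [map_add, map_smul, LinearMap.toMatrix_one]
    rw [this, h1]
    ext i j
    by_cases hij : i = j <;> simp [hij, add_comm] <;> exact mul_comm _ _

/-- Lagrange interpolation at `n + 1` points of `(0, ε)`, whose coefficients sum to `1`. -/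
lemma exists_interpolation_det (E : Type*) [NormedAddCommGroup E] [InnerProductSpace ℝ E]
    [FiniteDimensional ℝ E] {ε : ℝ} (hε : 0 < ε) :
    ∃ t c : Fin (Module.finrank ℝ E + 1) → ℝ, (∀ i, 0 < t i ∧ t i < ε) ∧ ∑ i, c i = 1 ∧
      ∀ A : E →L[ℝ] E,
        (1 + A).det = ∑ i, c i * (1 + t i • A).det := by
  set n := Module.finrank ℝ E
  let t : Fin (n + 1) → ℝ := fun i => ε * ((i : ℝ) + 1) / (n + 2)
  have hinj : InjOn t (Finset.univ : Finset (Fin (n + 1))) := by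
    intro i _ j _ h
    have h2 : (n : ℝ) + 2 ≠ 0 := by positivity
    simp only [t] at h
    field_simp at h
    have : (i : ℝ) = j := by linarith
    exact Fin.ext (by exact_mod_cast this)
  refine ⟨t, fun i => (Lagrange.basis Finset.univ t i).eval 1, fun i => ⟨by positivity, ?_⟩, ?_, ?_⟩
  · have : ((i : ℕ) : ℝ) + 1 < n + 2 := by exact_mod_cast (by omega : (i : ℕ) + 1 < n + 2)
    simp only [t]
    rw [div_lt_iff₀ (by positivity)]
    exact mul_lt_mul_of_pos_left this hε
  · rw [← eval_finsetSum, Lagrange.sum_basis hinj Finset.univ_nonempty, eval_one]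
  · intro A
    obtain ⟨p, hp, hpe⟩ := exists_polynomial_eval_eq_det_one_add_smul A
    have h1 := Lagrange.eq_interpolate (f := p) hinj (by
      simp only [Finset.card_univ, Fintype.card_fin]
      exact lt_of_le_of_lt degree_le_natDegree (by exact_mod_cast Nat.lt_succ_of_le hp))
    have h2 := congrArg (eval 1) h1
    rw [hpe, one_smul, Lagrange.interpolate_apply, eval_finsetSum] at h2
    rw [h2]
    refine Finset.sum_congr rfl fun i _ => ?_
    rw [eval_mul, eval_C, hpe, mul_comm]

lemma det_one_add_smul_pos {A : E →L[ℝ] E} {t : ℝ}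
    (ht : 0 ≤ t) (h : t * ‖A‖ < 1) : 0 < (1 + t • A).det := by
  have hne : ∀ s ∈ Icc 0 t, (1 + s • A).det ≠ 0 := by
    intro s hs h0
    have hu : IsUnit (1 - (-(s • A))) := isUnit_one_sub_of_norm_lt_one (by
      rw [norm_neg, norm_smul, Real.norm_of_nonneg hs.1]
      exact lt_of_le_of_lt (mul_le_mul_of_nonneg_right hs.2 (norm_nonneg _)) h)
    rw [sub_neg_eq_add] at hu
    obtain ⟨B, hB⟩ := hu.exists_right_inv
    have := congrArg ContinuousLinearMap.det hB
    rw [show (1 + s • A) * B = (1 + s • A).comp B from rfl] at this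
    simp only [ContinuousLinearMap.det] at this h0
    rw [ContinuousLinearMap.toLinearMap_comp, LinearMap.det_comp, h0] at this
    simp at this
  have hcont : Continuous fun s : ℝ => (1 + s • A).det :=
    ContinuousLinearMap.continuous_det.comp (by fun_prop)
  by_contra hneg
  have h0 : (1 + (0 : ℝ) • A).det = 1 := by simp [ContinuousLinearMap.det]
  obtain ⟨s, hs, hs0⟩ := intermediate_value_Icc' ht hcont.continuousOn
    (show (0 : ℝ) ∈ Icc _ _ from ⟨not_lt.1 hneg, by simp only [h0]; norm_num⟩)
  exact hne s hs hs0

/-- The ball admits no `C¹` retraction `r` onto its boundary. For small `t` the map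
`x ↦ x + t (r x - x)` is a diffeomorphism of the ball, so the integral of its Jacobian determinant
is the volume of the ball; being polynomial in `t`, the integral has this value also at `t = 1`,
where however the determinant vanishes. -/
theorem no_contDiff_retraction_closedBall (r : E → E)
    (hr : ∀ x ∈ closedBall 0 1, ContDiffAt ℝ 1 r x)
    (hmaps : ∀ x ∈ closedBall 0 1, ‖r x‖ = 1) (hfix : ∀ x, ‖x‖ = 1 → r x = x) : False := by
  let _ : MeasurableSpace E := borel E
  have _ : BorelSpace E := ⟨rfl⟩
  let A : E → E →L[ℝ] E := fun x => fderiv ℝ r x - 1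
  have hAcont : ContinuousOn A (closedBall 0 1) := fun x hx =>
    (((hr x hx).continuousAt_fderiv one_ne_zero).sub continuousAt_const).continuousWithinAt
  obtain ⟨K, hK⟩ := (isCompact_closedBall (0 : E) 1).exists_bound_of_continuousOn hAcont
  have hder : ∀ x ∈ closedBall (0 : E) 1, HasStrictFDerivAt (fun x => r x - x) (A x) x :=
    fun x hx => ((hr x hx).hasStrictFDerivAt one_ne_zero).sub (hasStrictFDerivAt_id x)
  have hlip : ∀ x ∈ closedBall (0 : E) 1, ∀ y ∈ closedBall (0 : E) 1,
      ‖(r y - y) - (r x - x)‖ ≤ K * ‖y - x‖ := fun x hx y hy =>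
    Convex.norm_image_sub_le_of_norm_hasFDerivWithin_le
      (fun z hz => (hder z hz).hasFDerivAt.hasFDerivWithinAt) hK (convex_closedBall 0 1) hx hy
  have hK0 : 0 ≤ K := (norm_nonneg _).trans (hK 0 (by simp))
  set ε := 1 / (K + 1) with hεdef
  have hε : 0 < ε := by positivity
  have hεK : ∀ t, 0 < t → t < ε → t * K < 1 ∧ t < 1 := by
    intro t ht h
    rw [hεdef, lt_div_iff₀ (by positivity)] at h
    constructor <;> nlinarith
  let F : ℝ → E → E := fun t x => x + t • (r x - x)
  have hFder : ∀ t, ∀ x ∈ closedBall (0 : E) 1, HasStrictFDerivAt (F t) (1 + t • A x) x :=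
    fun t x hx => (hasStrictFDerivAt_id x).add ((hder x hx).const_smul t)
  have hinj : ∀ t, 0 < t → t < ε → InjOn (F t) (closedBall 0 1) := by
    intro t ht hte x hx y hy hxy
    have h1 : x - y = t • ((r y - y) - (r x - x)) := by
      have : x + t • (r x - x) = y + t • (r y - y) := hxy
      have h2 := sub_eq_zero.2 this
      rw [← sub_eq_zero, ← h2]
      module
    have h2 : ‖x - y‖ ≤ t * K * ‖x - y‖ := by
      conv_lhs => rw [h1]
      rw [norm_smul, Real.norm_of_nonneg ht.le, mul_assoc, norm_sub_rev x y]
      exact mul_le_mul_of_nonneg_left (hlip x hx y hy) ht.le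
    have h3 := (hεK t ht hte).1
    have h4 : ‖x - y‖ ≤ 0 := by nlinarith [norm_nonneg (x - y)]
    exact sub_eq_zero.1 (norm_le_zero_iff.1 h4)
  have hdet : ∀ t, 0 < t → t < ε → ∀ x ∈ closedBall (0 : E) 1, 0 < (1 + t • A x).det := by
    intro t ht hte x hx
    refine det_one_add_smul_pos ht.le (lt_of_le_of_lt ?_ (hεK t ht hte).1)
    exact mul_le_mul_of_nonneg_left (hK x hx) ht.le
  have hnorm : ∀ t, 0 < t → t < 1 → ∀ x ∈ ball (0 : E) 1, F t x ∈ ball (0 : E) 1 := by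
    intro t ht ht1 x hx
    rw [mem_ball_zero_iff] at hx ⊢
    have : F t x = (1 - t) • x + t • r x := by simp only [F]; module
    rw [this]
    refine (norm_add_le _ _).trans_lt ?_
    rw [norm_smul, norm_smul, hmaps x (by simpa using hx.le), Real.norm_of_nonneg ht.le,
      Real.norm_of_nonneg (by linarith)]
    nlinarith
  -- The image of the open ball is open, and it is closed in the open ball since boundary points
  -- stay fixed.
  have hFimg : ∀ t, 0 < t → t < ε → F t '' ball 0 1 = ball 0 1 := by
    intro t ht hte
    have ht1 := (hεK t ht hte).2
    apply Subset.antisymm (MapsTo.image_subset fun x hx => hnorm t ht ht1 x hx)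
    have hopen : IsOpen (F t '' ball 0 1) := by
      rw [isOpen_iff_mem_nhds]
      rintro _ ⟨x, hx, rfl⟩
      have hx' := ball_subset_closedBall hx
      have hd := hdet t ht hte x hx'
      have hs := (hFder t x hx')
      have hmap := HasStrictFDerivAt.map_nhds_eq_of_equiv
        (f' := ContinuousLinearMap.toContinuousLinearEquivOfDetNeZero _ hd.ne') (by simpa using hs)
      rw [← hmap]
      exact Filter.image_mem_map (isOpen_ball.mem_nhds hx)
    have hFcont : ContinuousOn (F t) (closedBall 0 1) := fun x hx =>
      (hFder t x hx).continuousAt.continuousWithinAt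
    refine (convex_ball (0 : E) 1).isPreconnected.subset_of_closure_inter_subset hopen
      ⟨F t 0, hnorm t ht ht1 0 (by simp), mem_image_of_mem _ (by simp)⟩ ?_
    rintro y ⟨hy, hyb⟩
    have hcl : IsClosed (F t '' closedBall 0 1) :=
      ((isCompact_closedBall (0 : E) 1).image_of_continuousOn hFcont).isClosed
    obtain ⟨x, hx, rfl⟩ := hcl.closure_subset_iff.2 (image_mono ball_subset_closedBall) hy
    refine ⟨x, ?_, rfl⟩
    rcases (mem_closedBall_zero_iff.1 hx).lt_or_eq with h | h
    · simpa using h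
    · exfalso
      have hfx : F t x = x := by simp [F, hfix x h]
      rw [hfx, mem_ball_zero_iff] at hyb
      linarith
  have hvol : ∀ t, 0 < t → t < ε → ∫ x in ball (0 : E) 1, (1 + t • A x).det =
      ∫ _x in ball (0 : E) 1, (1 : ℝ) := by
    intro t ht hte
    have h := integral_image_eq_integral_abs_det_fderiv_smul (volume : Measure E)
      (measurableSet_ball (x := (0 : E)) (ε := 1))
      (fun x hx => (hFder t x (ball_subset_closedBall hx)).hasFDerivAt.hasFDerivWithinAt)
      ((hinj t ht hte).mono ball_subset_closedBall) (fun _ => (1 : ℝ))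
    rw [hFimg t ht hte] at h
    rw [h]
    refine setIntegral_congr_fun measurableSet_ball fun x hx => ?_
    simp [abs_of_pos (hdet t ht hte x (ball_subset_closedBall hx))]
  have hint : ∀ t : ℝ, IntegrableOn (fun x => (1 + t • A x).det) (ball (0 : E) 1) := by
    intro t
    refine IntegrableOn.mono_set (ContinuousOn.integrableOn_compact (isCompact_closedBall _ _) ?_)
      ball_subset_closedBall
    exact ContinuousLinearMap.continuous_det.comp_continuousOn
      (continuousOn_const.add (hAcont.const_smul t))
  -- The values of `r` have norm one, so that `r x` is orthogonal to the range of the derivative.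
  have hzero : ∀ x ∈ ball (0 : E) 1, (1 + A x).det = 0 := by
    intro x hx
    have hx' := ball_subset_closedBall hx
    have hd : HasFDerivAt r (fderiv ℝ r x) x :=
      ((hr x hx').hasStrictFDerivAt one_ne_zero).hasFDerivAt
    have h1 : 1 + A x = fderiv ℝ r x := by simp [A]
    rw [h1]
    by_contra hne
    have hsq : (fun y => inner ℝ (r y) (r y)) =ᶠ[nhds x] fun _ => (1 : ℝ) := by
      filter_upwards [isOpen_ball.mem_nhds hx] with y hy
      rw [real_inner_self_eq_norm_sq, hmaps y (ball_subset_closedBall hy), one_pow]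
    have hz := (hd.inner ℝ hd).unique ((hasFDerivAt_const (1 : ℝ) x).congr_of_eventuallyEq hsq)
    let e := ContinuousLinearMap.toContinuousLinearEquivOfDetNeZero _ hne
    have := DFunLike.congr_fun hz (e.symm (r x))
    have he : fderiv ℝ r x (e.symm (r x)) = r x := e.apply_symm_apply (r x)
    simp [he, fderivInnerCLM_apply, hmaps x hx'] at this
  obtain ⟨t, c, ht, hc, hA⟩ := exists_interpolation_det E hε
  have hfin : (0 : ℝ) = ∫ _x in ball (0 : E) 1, (1 : ℝ) := by
    calc (0 : ℝ) = ∫ x in ball (0 : E) 1, (1 + A x).det := by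
          rw [setIntegral_congr_fun measurableSet_ball (g := fun _ => (0 : ℝ)) hzero, integral_zero]
      _ = ∫ x in ball (0 : E) 1, ∑ i, c i * (1 + t i • A x).det :=
          congrArg _ (funext fun x => hA (A x))
      _ = ∑ i, c i * ∫ _x in ball (0 : E) 1, (1 : ℝ) := by
          rw [integral_finsetSum _ fun i _ => (hint (t i)).const_mul (c i)]
          refine Finset.sum_congr rfl fun i _ => ?_
          rw [integral_const_mul, hvol _ (ht i).1 (ht i).2]
      _ = _ := by rw [← Finset.sum_mul, hc, one_mul]
  have hpos : 0 < (volume : Measure E).real (ball (0 : E) 1) :=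
    ENNReal.toReal_pos (measure_ball_pos _ _ one_pos).ne' measure_ball_lt_top.ne
  simp only [setIntegral_const, smul_eq_mul, mul_one] at hfin
  linarith

end Brouwer

section InvarianceOfDomain

open MeasureTheory Metric Set

variable {E : Type*} [NormedAddCommGroup E] [InnerProductSpace ℝ E] [FiniteDimensional ℝ E]

/-- A smooth map from the closed unit ball to the open unit ball has a fixed point: otherwise
sending `x` to the point where the ray from `g x` through `x` leaves the ball is a smooth
retraction onto the sphere. -/
lemma exists_fixedPoint_of_contDiff (g : E → E) (hg : ContDiff ℝ 1 g)
    (hmaps : ∀ x ∈ closedBall (0 : E) 1, ‖g x‖ < 1) : ∃ x ∈ closedBall (0 : E) 1, g x = x := by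
  by_contra! hne
  let w : E → E := fun x => x - g x
  have hw : ContDiff ℝ 1 w := contDiff_id.sub hg
  -- `D x` is a quarter of the discriminant of the quadratic equation `‖x + l • w x‖ = 1` in `l`.
  let D : E → ℝ := fun x => inner ℝ x (w x) ^ 2 + ‖w x‖ ^ 2 * (1 - ‖x‖ ^ 2)
  have hD : ContDiff ℝ 1 D :=
    ((contDiff_id.inner ℝ hw).pow 2).add
      ((hw.norm_sq ℝ).mul (contDiff_const.sub (contDiff_id.norm_sq ℝ)))
  have hw0 : ∀ x ∈ closedBall (0 : E) 1, 0 < ‖w x‖ ^ 2 := fun x hx => by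
    have : w x ≠ 0 := fun h => hne x hx (sub_eq_zero.1 h).symm
    positivity
  have hinner : ∀ x, ‖x‖ = 1 → 0 < inner ℝ x (w x) := by
    intro x hx
    have h1 := hmaps x (by simp [hx])
    have h2 := real_inner_le_norm x (g x)
    rw [hx, one_mul] at h2
    simp only [w, inner_sub_right, real_inner_self_eq_norm_sq, hx]
    linarith
  have hDpos : ∀ x ∈ closedBall (0 : E) 1, 0 < D x := by
    intro x hx
    have := hw0 x hx
    rcases (mem_closedBall_zero_iff.1 hx).lt_or_eq with h | h
    · have : 0 < 1 - ‖x‖ ^ 2 := by nlinarith [norm_nonneg x]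
      simp only [D]
      positivity
    · have := hinner x h
      simp only [D, h]
      nlinarith
  let l : E → ℝ := fun x => (-inner ℝ x (w x) + √(D x)) / ‖w x‖ ^ 2
  refine no_contDiff_retraction_closedBall (fun x => x + l x • w x) ?_ ?_ ?_
  · intro x hx
    refine contDiffAt_id.add (ContDiffAt.smul (ContDiffAt.div ?_ ?_ (hw0 x hx).ne') hw.contDiffAt)
    · exact ((contDiff_id.inner ℝ hw).neg.contDiffAt).add (hD.contDiffAt.sqrt (hDpos x hx).ne')
    · exact (hw.norm_sq ℝ).contDiffAt
  · intro x hx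
    have h1 : ‖x + l x • w x‖ ^ 2 = 1 := by
      rw [norm_add_sq_real, norm_smul, mul_pow, inner_smul_right, Real.norm_eq_abs, sq_abs]
      have hs := Real.sq_sqrt (hDpos x hx).le
      have hl : l x * ‖w x‖ ^ 2 = -inner ℝ x (w x) + √(D x) := div_mul_cancel₀ _ (hw0 x hx).ne'
      have hDx : D x = inner ℝ x (w x) ^ 2 + ‖w x‖ ^ 2 * (1 - ‖x‖ ^ 2) := rfl
      have hsq : (l x * ‖w x‖ ^ 2 + inner ℝ x (w x)) ^ 2 = D x := by
        rw [hl]; linear_combination hs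
      rw [hDx] at hsq
      have : ‖w x‖ ^ 2 * (‖x‖ ^ 2 + 2 * (l x * inner ℝ x (w x)) + l x ^ 2 * ‖w x‖ ^ 2)
          = ‖w x‖ ^ 2 * 1 := by linear_combination hsq
      exact mul_left_cancel₀ (hw0 x hx).ne' this
    exact (pow_eq_one_iff_of_nonneg (norm_nonneg _) two_ne_zero).1 h1
  · intro x hx
    have hl : l x = 0 := by
      have : √(D x) = inner ℝ x (w x) := by
        rw [show D x = inner ℝ x (w x) ^ 2 by simp [D, hx]]
        exact Real.sqrt_sq (hinner x hx).le
      simp [l, this]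
    simp [hl]

/-- **Brouwer's fixed point theorem** for the closed unit ball. -/
theorem exists_fixedPoint_closedBall (f : E → E) (hf : ContinuousOn f (closedBall 0 1))
    (hmaps : MapsTo f (closedBall 0 1) (closedBall 0 1)) :
    ∃ x ∈ closedBall (0 : E) 1, f x = x := by
  by_contra! hne
  obtain ⟨δ, hδ, hδf⟩ : ∃ δ > 0, ∀ x ∈ closedBall (0 : E) 1, δ ≤ ‖f x - x‖ := by
    obtain ⟨x, hx, hmin⟩ := (isCompact_closedBall (0 : E) 1).exists_isMinOn ⟨0, by simp⟩
      (f := fun x => ‖f x - x‖) (hf.sub continuousOn_id).norm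
    exact ⟨‖f x - x‖, norm_pos_iff.2 (sub_ne_zero.2 (hne x hx)), fun y hy => hmin hy⟩
  -- Extend `f` to the whole space by precomposing with the radial retraction onto the ball.
  let p : E → E := fun x => (max 1 ‖x‖)⁻¹ • x
  have hmax : ∀ x : E, 0 < max 1 ‖x‖ := fun x => lt_max_of_lt_left one_pos
  have hp : Continuous p := Continuous.smul
    ((continuous_const.max continuous_norm).inv₀ fun x => (hmax x).ne') continuous_id
  have hpB : ∀ x, p x ∈ closedBall (0 : E) 1 := by
    intro x
    rw [mem_closedBall_zero_iff, norm_smul, norm_inv, Real.norm_of_nonneg (hmax x).le,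
      inv_mul_le_iff₀ (hmax x), mul_one]
    exact le_max_right _ _
  have hpid : ∀ x ∈ closedBall (0 : E) 1, p x = x := by
    intro x hx
    simp [p, max_eq_left (mem_closedBall_zero_iff.1 hx)]
  have hF : Continuous (f ∘ p) := hf.comp_continuous hp hpB
  set η := δ / 2 with hη
  have hη0 : 0 < η := by positivity
  obtain ⟨h, hh, hhF, -⟩ := hF.exists_contDiff_approx 1 (ε := fun _ => η) continuous_const
    fun _ => hη0
  have hFn : ∀ x, ‖(f ∘ p) x‖ ≤ 1 := fun x => mem_closedBall_zero_iff.1 (hmaps (hpB x))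
  have hη1 : 0 < 1 + η := by positivity
  obtain ⟨x, hx, hfix⟩ := exists_fixedPoint_of_contDiff (fun x => (1 + η)⁻¹ • h x)
    (hh.const_smul _) (by
      intro x _
      rw [norm_smul, norm_inv, Real.norm_of_nonneg hη1.le, inv_mul_lt_iff₀ hη1, mul_one]
      have h1 := hhF x
      rw [dist_eq_norm] at h1
      have h2 := norm_sub_norm_le (h x) ((f ∘ p) x)
      linarith [hFn x])
  have hhx : h x = (1 + η) • x := by
    rw [← hfix, smul_smul, mul_inv_cancel₀ hη1.ne', one_smul, hfix]
  have h1 := hhF x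
  have h2 := hδf x hx
  rw [dist_eq_norm, hhx, Function.comp_apply, hpid x hx] at h1
  have h3 : f x - x = η • x - ((1 + η) • x - f x) := by module
  have h4 := norm_sub_le (η • x) ((1 + η) • x - f x)
  rw [← h3, norm_smul, Real.norm_of_nonneg hη0.le] at h4
  have h5 := mem_closedBall_zero_iff.1 hx
  nlinarith

/-- A map of the ball that moves no point by more than `1` has a zero. -/
lemma exists_zero_of_norm_sub_le {H : E → E} (hH : ContinuousOn H (closedBall 0 1))
    (h : ∀ x ∈ closedBall (0 : E) 1, ‖H x - x‖ ≤ 1) : ∃ x ∈ closedBall (0 : E) 1, H x = 0 := by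
  obtain ⟨x, hx, hfix⟩ := exists_fixedPoint_closedBall (fun x => x - H x)
    (continuousOn_id.sub hH) (fun x hx => by
      rw [mem_closedBall_zero_iff, norm_sub_rev]; exact h x hx)
  exact ⟨x, hx, by simpa using hfix⟩

/-! ### Invariance of domain -/

/-- An injective continuous map `f` of the ball has `f 0` in the interior of its image. Let `G`
extend the inverse of `f` to the whole space. If some `c` near `f 0` is not in the image, pushing
the image radially off a small ball about `c` and approximating `G` by a smooth map, which maps
the sphere about `c` to a null set, gives a perturbation of `G` with no zero on the image,
contradicting `exists_zero_of_norm_sub_le`. -/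
lemma mem_interior_image_closedBall (f : E → E) (hf : ContinuousOn f (closedBall 0 1))
    (hinj : InjOn f (closedBall 0 1)) : f 0 ∈ interior (f '' closedBall 0 1) := by
  let _ : MeasurableSpace E := borel E
  have _ : BorelSpace E := ⟨rfl⟩
  by_contra hint
  set B := closedBall (0 : E) 1 with hB
  set K := f '' B with hK
  have h0B : (0 : E) ∈ B := by simp [hB]
  have hKc : IsCompact K := (isCompact_closedBall 0 1).image_of_continuousOn hf
  obtain ⟨G, hG⟩ : ∃ G : C(E, E), ∀ x ∈ B, G (f x) = x := by
    have : CompactSpace B := isCompact_iff_compactSpace.1 (isCompact_closedBall 0 1)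
    have he : Topology.IsClosedEmbedding (B.domRestrict f) :=
      (continuousOn_iff_continuous_domRestrict.1 hf).isClosedEmbedding
        (injOn_iff_injective.1 hinj)
    obtain ⟨G, hG⟩ := ContinuousMap.exists_extension he
      (⟨Subtype.val, continuous_subtype_val⟩ : C(B, E))
    exact ⟨G, fun x hx => DFunLike.congr_fun hG ⟨x, hx⟩⟩
  obtain ⟨ε, hε, hGε⟩ : ∃ ε > 0, ∀ y, dist y (f 0) < 2 * ε → ‖G y‖ ≤ 1 / 10 := by
    obtain ⟨ε, hε, h⟩ := Metric.continuous_iff.1 G.continuous (f 0) (1 / 10) (by norm_num)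
    refine ⟨ε / 2, by positivity, fun y hy => ?_⟩
    have := (h y (by linarith)).le
    rwa [hG 0 h0B, dist_zero_right] at this
  obtain ⟨c, hcK, hc⟩ : ∃ c, c ∉ K ∧ dist c (f 0) < ε := by
    by_contra! h
    refine hint (mem_interior_iff_mem_nhds.2 (Metric.mem_nhds_iff.2 ⟨ε, hε, fun y hy => ?_⟩))
    by_contra hyK
    exact absurd (h y hyK) (not_le.2 hy)
  obtain ⟨δ, hδ, hδ1, hGδ⟩ : ∃ δ > 0, δ ≤ 1 / 10 ∧ ∀ y ∈ K, ε ≤ dist y c → δ ≤ ‖G y‖ := by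
    have hS : IsCompact (K ∩ {y | ε ≤ dist y c}) :=
      hKc.inter_right (isClosed_le continuous_const (continuous_id.dist continuous_const))
    have hpos : ∀ y ∈ K ∩ {y | ε ≤ dist y c}, 0 < ‖G y‖ := by
      rintro _ ⟨⟨x, hx, rfl⟩, hxc⟩
      rw [hG x hx, norm_pos_iff]
      rintro rfl
      rw [mem_ofPred_eq, dist_comm] at hxc
      linarith
    rcases (K ∩ {y | ε ≤ dist y c}).eq_empty_or_nonempty with he | hne
    · exact ⟨1 / 10, by norm_num, le_rfl, fun y hy hyc => by
        have : y ∈ K ∩ {y | ε ≤ dist y c} := ⟨hy, hyc⟩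
        simp [he] at this⟩
    · obtain ⟨y, hy, hmin⟩ := hS.exists_isMinOn hne (f := fun y => ‖G y‖)
        G.continuous.norm.continuousOn
      exact ⟨min ‖G y‖ (1 / 10), lt_min (hpos y hy) (by norm_num), min_le_right _ _,
        fun z hz hzc => (min_le_left _ _).trans (hmin ⟨hz, hzc⟩)⟩
  obtain ⟨P, hP, hPG, -⟩ := G.continuous.exists_contDiff_approx 1 (ε := fun _ => δ / 2)
    continuous_const fun _ => by positivity
  -- `P - v` has no zero on the sphere about `c`, the image of which under `P` is a null set.
  obtain ⟨v, hv, hvP⟩ : ∃ v ∈ ball (0 : E) (δ / 2), v ∉ P '' sphere c ε := by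
    by_contra! h
    have h0 := addHaar_image_eq_zero_of_differentiableOn_of_addHaar_eq_zero volume
      (hP.differentiable one_ne_zero).differentiableOn
      (Measure.addHaar_sphere_of_ne_zero volume c hε.ne')
    exact (measure_ball_pos volume (0 : E) (half_pos hδ)).ne' (measure_mono_null h h0)
  -- `Φ` pushes the punctured ball of radius `ε` about `c` radially to its boundary sphere.
  let Φ : E → E := fun y => c + (max 1 (ε / dist y c)) • (y - c)
  have hcx : ∀ x ∈ B, 0 < dist (f x) c := fun x hx =>
    dist_pos.2 fun h => hcK (h ▸ mem_image_of_mem f hx)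
  have hΦfar : ∀ x ∈ B, ε ≤ dist (f x) c → Φ (f x) = f x := by
    intro x hx h
    have : ε / dist (f x) c ≤ 1 := (div_le_one (hcx x hx)).2 h
    simp [Φ, max_eq_left this]
  have hΦnear : ∀ x ∈ B, dist (f x) c < ε → Φ (f x) ∈ sphere c ε := by
    intro x hx h
    have h1 : 1 ≤ ε / dist (f x) c := (one_le_div (hcx x hx)).2 h.le
    have h2 := hcx x hx
    rw [mem_sphere, dist_eq_norm, add_sub_cancel_left, max_eq_right h1, norm_smul,
      Real.norm_of_nonneg (by positivity), ← dist_eq_norm, div_mul_cancel₀ _ h2.ne']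
  obtain ⟨x, hx, hzero⟩ := exists_zero_of_norm_sub_le (H := fun x => P (Φ (f x)) - v) (by
      refine (hP.continuous.comp_continuousOn ?_).sub continuousOn_const
      refine continuousOn_const.add (ContinuousOn.smul ?_ (hf.sub continuousOn_const))
      exact (continuous_const.max continuous_id).comp_continuousOn (continuousOn_const.div
        ((continuous_id.dist continuous_const).comp_continuousOn hf)
          fun x hx => (hcx x hx).ne')) (by
    intro x hx
    have hvn := mem_ball_zero_iff.1 hv
    have hPx := hPG (Φ (f x))
    rw [dist_eq_norm] at hPx
    have hclose : ‖G (Φ (f x)) - G (f x)‖ ≤ 1 / 5 := by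
      rcases le_or_gt ε (dist (f x) c) with h | h
      · rw [hΦfar x hx h, sub_self, norm_zero]
        norm_num
      · have h1 := hGε (f x) (by linarith [dist_triangle (f x) c (f 0)])
        have h2 := hGε (Φ (f x)) (by
          have := mem_sphere.1 (hΦnear x hx h)
          linarith [dist_triangle (Φ (f x)) c (f 0)])
        linarith [norm_sub_le (G (Φ (f x))) (G (f x))]
    have hsum : P (Φ (f x)) - v - x =
        (P (Φ (f x)) - G (Φ (f x))) + (G (Φ (f x)) - G (f x)) - v := by
      rw [hG x hx]; abel
    rw [hsum]
    linarith [norm_sub_le ((P (Φ (f x)) - G (Φ (f x))) + (G (Φ (f x)) - G (f x))) v,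
      norm_add_le (P (Φ (f x)) - G (Φ (f x))) (G (Φ (f x)) - G (f x))])
  have hPv : P (Φ (f x)) = v := sub_eq_zero.1 hzero
  rcases le_or_gt ε (dist (f x) c) with h | h
  · have h1 := hGδ (f x) (mem_image_of_mem f hx) h
    have h2 := hPG (f x)
    rw [hΦfar x hx h] at hPv
    rw [hPv, dist_eq_norm] at h2
    have hvn := mem_ball_zero_iff.1 hv
    have h3 := norm_sub_le v (v - G (f x))
    rw [sub_sub_cancel] at h3
    linarith
  · exact hvP ⟨_, hΦnear x hx h, hPv⟩

/-- **Invariance of domain**: an injective continuous map from an open subset of a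
finite-dimensional space to the same space is open. -/
theorem isOpen_image_of_continuousOn_injOn {f : E → E} {U : Set E} (hU : IsOpen U)
    (hf : ContinuousOn f U) (hinj : InjOn f U) : IsOpen (f '' U) := by
  rw [isOpen_iff_mem_nhds]
  rintro _ ⟨x, hx, rfl⟩
  obtain ⟨ρ, hρ, hball⟩ := Metric.nhds_basis_closedBall.mem_iff.1 (hU.mem_nhds hx)
  have hmaps : MapsTo (fun z => x + ρ • z) (closedBall (0 : E) 1) U := by
    intro z hz
    apply hball
    rw [mem_closedBall, dist_eq_norm, add_sub_cancel_left, norm_smul, Real.norm_of_nonneg hρ.le]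
    nlinarith [mem_closedBall_zero_iff.1 hz]
  have h := mem_interior_image_closedBall (fun z => f (x + ρ • z))
    (hf.comp (by fun_prop) hmaps) (fun y hy z hz hyz => by
      have := hinj (hmaps hy) (hmaps hz) hyz
      simpa [hρ.ne'] using this)
  rw [smul_zero, add_zero] at h
  refine Filter.mem_of_superset (mem_interior_iff_mem_nhds.1 h) ?_
  rintro _ ⟨z, hz, rfl⟩
  exact mem_image_of_mem f (hmaps hz)

/-- A nonempty open subset of a finite-dimensional space does not embed in a space of smaller
dimension. -/
theorem finrank_le_of_continuousOn_injOn {F : Type*} [NormedAddCommGroup F]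
    [InnerProductSpace ℝ F] [FiniteDimensional ℝ F] {f : E → F} {U : Set E} (hU : IsOpen U)
    (hne : U.Nonempty) (hf : ContinuousOn f U) (hinj : InjOn f U) :
    Module.finrank ℝ E ≤ Module.finrank ℝ F := by
  by_contra! hlt
  obtain ⟨L, hL⟩ : ∃ L : F →ₗ[ℝ] E, Function.Injective L := by
    let e := (Module.finBasis ℝ F).equivFun
    let e' := (Module.finBasis ℝ E).equivFun
    let i : (Fin (Module.finrank ℝ F) → ℝ) →ₗ[ℝ] (Fin (Module.finrank ℝ E) → ℝ) :=
      Function.ExtendByZero.linearMap ℝ (Fin.castLE hlt.le)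
    have hi : Function.Injective i := by
      intro a b hab
      funext j
      have h : Function.extend (Fin.castLE hlt.le) a 0 (Fin.castLE hlt.le j) =
        Function.extend (Fin.castLE hlt.le) b 0 (Fin.castLE hlt.le j) := congrFun hab _
      rwa [(Fin.castLE_injective hlt.le).extend_apply,
        (Fin.castLE_injective hlt.le).extend_apply] at h
    exact ⟨e'.symm.toLinearMap ∘ₗ i ∘ₗ e.toLinearMap,
      e'.symm.injective.comp (hi.comp e.injective)⟩
  have hopen := isOpen_image_of_continuousOn_injOn hU
    (L.continuous_of_finiteDimensional.comp_continuousOn hf) (fun x hx y hy h => hinj hx hy (hL h))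
  have htop : LinearMap.range L = ⊤ := by
    refine Submodule.eq_top_of_nonempty_interior' _ ?_
    obtain ⟨x, hx⟩ := hne
    refine ⟨L (f x), mem_interior.2 ⟨_, ?_, hopen, ⟨x, hx, rfl⟩⟩⟩
    rintro _ ⟨y, _, rfl⟩
    exact ⟨f y, rfl⟩
  have := LinearMap.finrank_range_le L
  rw [htop, finrank_top] at this
  omega

end InvarianceOfDomain

section SphereDomain

open Metric Set

/-- A linear isomorphism of normed spaces induces, by rescaling, a homeomorphism of unit spheres. -/
noncomputable def ContinuousLinearEquiv.unitSphereHomeomorph {E F : Type*} [NormedAddCommGroup E]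
    [NormedSpace ℝ E] [NormedAddCommGroup F] [NormedSpace ℝ F] (L : E ≃L[ℝ] F) :
    sphere (0 : E) 1 ≃ₜ sphere (0 : F) 1 :=
  have hL : ∀ x : sphere (0 : E) 1, ‖L x‖ ≠ 0 := fun x h =>
    ne_zero_of_mem_unit_sphere x (L.injective (by simpa using h))
  have hL' : ∀ y : sphere (0 : F) 1, ‖L.symm y‖ ≠ 0 := fun y h =>
    ne_zero_of_mem_unit_sphere y (L.symm.injective (by simpa using h))
  { toFun := fun x => ⟨‖L x‖⁻¹ • L x, by simp [norm_smul, hL x]⟩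
    invFun := fun y => ⟨‖L.symm y‖⁻¹ • L.symm y, by simp [norm_smul, hL' y]⟩
    left_inv := fun x => Subtype.ext (by
      have := hL x
      simp [norm_smul, smul_smul, this])
    right_inv := fun y => Subtype.ext (by
      have := hL' y
      simp [norm_smul, smul_smul, this])
    continuous_toFun := by
      refine Continuous.subtype_mk (Continuous.smul (Continuous.inv₀ ?_ hL) ?_) _ <;> fun_prop
    continuous_invFun := by
      refine Continuous.subtype_mk (Continuous.smul (Continuous.inv₀ ?_ hL') ?_) _ <;> fun_prop }

/-- The unit spheres of the sup norm and of the Euclidean norm are homeomorphic. -/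
noncomputable def supSphereHomeomorph (n : ℕ) :
    sphere (0 : Fin n → ℝ) 1 ≃ₜ sphere (0 : EuclideanSpace ℝ (Fin n)) 1 :=
  (EuclideanSpace.equiv (Fin n) ℝ).symm.unitSphereHomeomorph

/-- The sphere of dimension `m` is locally parametrized by open subsets of `ℝᵐ`. -/
lemma exists_sphere_chart {m : ℕ} (s : sphere (0 : Fin (m + 1) → ℝ) 1) :
    ∃ φ : OpenPartialHomeomorph (sphere (0 : Fin (m + 1) → ℝ) 1) (EuclideanSpace ℝ (Fin m)),
      s ∈ φ.source := by
  have : Fact (Module.finrank ℝ (EuclideanSpace ℝ (Fin (m + 1))) = m + 1) := ⟨by simp⟩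
  let e := supSphereHomeomorph (m + 1)
  exact ⟨e.toOpenPartialHomeomorph.trans (chartAt (EuclideanSpace ℝ (Fin m)) (e s)), by simp⟩

/-- Invariance of domain for maps from an open subset of a sphere to `ℝᵏ`. -/
theorem isOpen_image_of_sphere {n k : ℕ} {V : Set (sphere (0 : Fin n → ℝ) 1)} (hV : IsOpen V)
    (hne : V.Nonempty) {h : sphere (0 : Fin n → ℝ) 1 → Fin k → ℝ} (hc : ContinuousOn h V)
    (hinj : InjOn h V) : n ≤ k + 1 ∧ (n = k + 1 → IsOpen (h '' V)) := by
  have key : ∀ m, n = m + 1 → ∀ s ∈ V, m ≤ k ∧ (m = k → h '' V ∈ nhds (h s)) := by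
    rintro m rfl s hs
    obtain ⟨φ, hφ⟩ := exists_sphere_chart s
    let U := φ.target ∩ φ.symm ⁻¹' V
    have hU : IsOpen U := φ.isOpen_inter_preimage_symm hV
    have hsU : φ s ∈ U := ⟨φ.map_source hφ, by simpa [φ.left_inv hφ] using hs⟩
    let L := (EuclideanSpace.equiv (Fin k) ℝ).symm
    have hfc : ContinuousOn (fun x => L (h (φ.symm x))) U :=
      L.continuous.comp_continuousOn (hc.comp (φ.continuousOn_symm.mono inter_subset_left)
        fun x hx => hx.2)
    have hfi : InjOn (fun x => L (h (φ.symm x))) U := fun x hx y hy hxy =>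
      φ.symm.injOn hx.1 hy.1 (hinj hx.2 hy.2 (L.injective hxy))
    refine ⟨by simpa using finrank_le_of_continuousOn_injOn hU ⟨_, hsU⟩ hfc hfi, ?_⟩
    rintro rfl
    have hopen := isOpen_image_of_continuousOn_injOn hU hfc hfi
    have himg : IsOpen (L ⁻¹' ((fun x => L (h (φ.symm x))) '' U)) := hopen.preimage L.continuous
    refine Filter.mem_of_superset (himg.mem_nhds ⟨φ s, hsU, by simp [φ.left_inv hφ]⟩) ?_
    rintro y ⟨x, hx, hxy⟩
    exact ⟨φ.symm x, hx.2, L.injective hxy⟩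
  obtain ⟨s, hs⟩ := hne
  obtain ⟨m, rfl⟩ : ∃ m, n = m + 1 := by
    refine Nat.exists_eq_succ_of_ne_zero ?_
    rintro rfl
    have := s.2
    simp [sphere_eq_empty_of_subsingleton] at this
  refine ⟨Nat.succ_le_succ (key m rfl s hs).1, fun hm => isOpen_iff_mem_nhds.2 ?_⟩
  rintro _ ⟨t, ht, rfl⟩
  exact (key m rfl t ht).2 (by omega)

/-- A nonempty open subset of `ℝᵐ` does not embed in a sphere of dimension less than `m`. -/
theorem lt_of_continuousOn_injOn_sphere {n m : ℕ} {U : Set (Fin m → ℝ)} (hU : IsOpen U)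
    (hne : U.Nonempty) {h : (Fin m → ℝ) → sphere (0 : Fin n → ℝ) 1} (hc : ContinuousOn h U)
    (hinj : InjOn h U) : m < n := by
  obtain ⟨u, hu⟩ := hne
  obtain ⟨k, rfl⟩ : ∃ k, n = k + 1 := by
    refine Nat.exists_eq_succ_of_ne_zero ?_
    rintro rfl
    have := (h u).2
    simp [sphere_eq_empty_of_subsingleton] at this
  obtain ⟨φ, hφ⟩ := exists_sphere_chart (h u)
  have hU' : IsOpen (U ∩ h ⁻¹' φ.source) := hc.isOpen_inter_preimage hU φ.open_source
  let L := EuclideanSpace.equiv (Fin m) ℝ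
  have := finrank_le_of_continuousOn_injOn (hU'.preimage L.continuous)
    ⟨L.symm u, by simpa using ⟨hu, hφ⟩⟩ (f := fun x => φ (h (L x)))
    (φ.continuousOn.comp (hc.comp L.continuous.continuousOn fun x hx => hx.1) fun x hx => hx.2)
    (fun x hx y hy hxy => L.injective (hinj hx.1 hy.1 (φ.injOn hx.2 hy.2 hxy)))
  simp only [finrank_euclideanSpace, Fintype.card_fin] at this
  omega

end SphereDomain

/-! ### Boundaries of cells in regular CW complexes -/

section RegularCW

open Metric Set Topology Topology.RelCWComplex

variable {X : Type u} [TopologicalSpace X] [CWComplex (univ : Set X)]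

lemma IsRegularCW.injOn_map (hX : IsRegularCW X) (n : ℕ) (i : cell (univ : Set X) n) :
    InjOn (map n i) (closedBall 0 1) :=
  injOn_iff_injective.2 (hX n i).injective

lemma exists_finset_cellFrontier_subset (n : ℕ) (e : cell (univ : Set X) n) :
    ∃ I : Finset (Σ m, cell (univ : Set X) m), (∀ c ∈ I, c.1 < n) ∧
      ∀ x ∈ cellFrontier n e, ∃ c ∈ I, x ∈ openCell c.1 c.2 := by
  obtain ⟨I, hI⟩ := CWComplex.cellFrontier_subset_finite_openCell n e
  refine ⟨(Finset.range n).sigma I, fun c hc => by simp at hc; exact hc.1, fun x hx => ?_⟩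
  have := hI hx
  simp only [mem_iUnion] at this
  obtain ⟨m, hm, j, hj, hxj⟩ := this
  exact ⟨⟨m, j⟩, by simp [hm, hj], hxj⟩

lemma disjoint_openCell_closedCell {c d : Σ m, cell (univ : Set X) m} (hne : c ≠ d)
    (hle : d.1 ≤ c.1) : Disjoint (openCell c.1 c.2) (closedCell d.1 d.2) := by
  rw [← cellFrontier_union_openCell_eq_closedCell, disjoint_union_right]
  refine ⟨?_, disjoint_openCell_of_ne hne⟩
  obtain ⟨I, hI, hsub⟩ := exists_finset_cellFrontier_subset d.1 d.2
  rw [disjoint_right]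
  intro x hx hxc
  obtain ⟨b, hb, hxb⟩ := hsub x hx
  have hbc : c ≠ b := fun h => by
    have := hI b hb
    rw [← h] at this
    omega
  exact (disjoint_left.1 (disjoint_openCell_of_ne hbc)) hxc hxb

/-- Invariance of domain for a relatively open part of the boundary of a cell that lies in a single
open cell. -/
lemma isOpen_symm_image_cellFrontier (hX : IsRegularCW X) {n k : ℕ} (e : cell (univ : Set X) n)
    (i : cell (univ : Set X) k) {O : Set X} (hO : IsOpen O)
    (hne : (cellFrontier n e ∩ O).Nonempty) (hsub : cellFrontier n e ∩ O ⊆ openCell k i) :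
    n ≤ k + 1 ∧ (n = k + 1 → IsOpen ((map k i).symm '' (cellFrontier n e ∩ O))) := by
  let g : sphere (0 : Fin n → ℝ) 1 → X := fun s => map n e s
  have hg : Continuous g :=
    ((continuousOn n e).mono sphere_subset_closedBall).comp_continuous continuous_subtype_val
      fun s => s.2
  have hgimg : g '' (g ⁻¹' O) = cellFrontier n e ∩ O := by
    ext x
    constructor
    · rintro ⟨s, hs, rfl⟩
      exact ⟨mem_image_of_mem _ s.2, hs⟩
    · rintro ⟨⟨s, hs, rfl⟩, hx⟩
      exact ⟨⟨s, hs⟩, hx, rfl⟩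
  have htgt : (map k i).target = openCell k i := by
    rw [openCell, ← source_eq k i, PartialEquiv.image_source_eq_target]
  have hmaps : MapsTo g (g ⁻¹' O) (map k i).target := fun s hs => by
    rw [htgt]
    exact hsub (hgimg ▸ mem_image_of_mem g hs)
  have := isOpen_image_of_sphere (hO.preimage hg) (h := fun s => (map k i).symm (g s)) (by
      obtain ⟨_, hx⟩ := hne
      rw [← hgimg] at hx
      exact hx.imp fun _ h => h.1)
    ((continuousOn_symm k i).comp hg.continuousOn hmaps) (fun s hs t ht hst => by
      have := (map k i).symm.injOn (hmaps hs) (hmaps ht) hst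
      exact Subtype.ext (hX.injOn_map n e (sphere_subset_closedBall s.2)
        (sphere_subset_closedBall t.2) this))
  rwa [← hgimg, image_image]

variable [T2Space X]

/-- A cell of codimension one in a cell `e` that meets the boundary of `e` lies in it: the common
part is open in the cell by invariance of domain, and it is closed. -/
lemma openCell_subset_cellFrontier_of_succ (hX : IsRegularCW X) {m : ℕ}
    (e : cell (univ : Set X) (m + 1)) (i : cell (univ : Set X) m)
    (h : ¬ Disjoint (openCell m i) (cellFrontier (m + 1) e)) :
    openCell m i ⊆ cellFrontier (m + 1) e := by
  obtain ⟨I, hI, hsub⟩ := exists_finset_cellFrontier_subset (m + 1) e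
  set Z : Set X := ⋃ c ∈ {c ∈ (I : Set (Σ m, cell (univ : Set X) m)) | c ≠ ⟨m, i⟩},
    closedCell c.1 c.2 with hZ
  have hZc : IsClosed Z :=
    (I.finite_toSet.subset (sep_subset _ _)).isClosed_biUnion fun c _ => isClosed_closedCell
  have hdisj : Disjoint (openCell m i) Z := by
    rw [hZ, disjoint_iUnion₂_right]
    intro c hc
    exact disjoint_openCell_closedCell (c := ⟨m, i⟩) hc.2.symm (Nat.lt_succ_iff.1 (hI c hc.1))
  have heq : cellFrontier (m + 1) e ∩ Zᶜ = cellFrontier (m + 1) e ∩ openCell m i := by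
    ext x
    refine and_congr_right fun hx => ⟨fun hxZ => ?_, fun hxi => disjoint_left.1 hdisj hxi⟩
    obtain ⟨c, hc, hxc⟩ := hsub x hx
    by_cases hci : c = ⟨m, i⟩
    · rw [hci] at hxc; exact hxc
    · exact absurd (mem_biUnion (show c ∈ {c ∈ (I : Set _) | c ≠ ⟨m, i⟩} from ⟨hc, hci⟩)
        (openCell_subset_closedCell _ _ hxc)) hxZ
  obtain ⟨x, hxi, hxe⟩ := not_disjoint_iff.1 h
  have hopen := (isOpen_symm_image_cellFrontier hX e i hZc.isOpen_compl
    (heq ▸ ⟨x, hxe, hxi⟩) (heq ▸ inter_subset_right)).2 rfl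
  rw [heq] at hopen
  have hmem : ∀ y ∈ ball (0 : Fin m → ℝ) 1,
      y ∈ (map m i).symm '' (cellFrontier (m + 1) e ∩ openCell m i) ↔
        map m i y ∈ cellFrontier (m + 1) e := by
    intro y hy
    have hy' : y ∈ (map m i).source := by rwa [source_eq]
    constructor
    · rintro ⟨z, ⟨hze, w, hw, rfl⟩, rfl⟩
      rw [(map m i).left_inv (by rwa [source_eq])]
      exact hze
    · intro h
      exact ⟨_, ⟨h, mem_image_of_mem _ hy⟩, (map m i).left_inv hy'⟩
  have hball : ball (0 : Fin m → ℝ) 1 ⊆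
      (map m i).symm '' (cellFrontier (m + 1) e ∩ openCell m i) := by
    refine (convex_ball _ _).isPreconnected.subset_of_closure_inter_subset hopen ?_ ?_
    · obtain ⟨y, hy, rfl⟩ := hxi
      exact ⟨y, hy, (hmem y hy).2 hxe⟩
    · rintro y ⟨hyc, hy⟩
      rw [hmem y hy]
      have hcont : ContinuousAt (map m i) y :=
        (continuousOn m i).continuousAt (Filter.mem_of_superset (isOpen_ball.mem_nhds hy)
          ball_subset_closedBall)
      by_contra hne
      have hev := hcont.preimage_mem_nhds
        ((isClosed_cellFrontier (n := m + 1) (i := e)).isOpen_compl.mem_nhds hne)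
      obtain ⟨z, ⟨hz1, hz2⟩, hz⟩ :=
        mem_closure_iff_nhds.1 hyc _ (Filter.inter_mem hev (isOpen_ball.mem_nhds hy))
      exact hz1 ((hmem z hz2).1 hz)
  rintro _ ⟨y, hy, rfl⟩
  exact (hmem y hy).1 (hball hy)

/-- In a regular CW complex, the boundary of a cell is a union of open cells. -/
theorem openCell_subset_cellFrontier (hX : IsRegularCW X) (n : ℕ) (e : cell (univ : Set X) n)
    (c : Σ m, cell (univ : Set X) m) (h : ¬ Disjoint (openCell c.1 c.2) (cellFrontier n e)) :
    openCell c.1 c.2 ⊆ cellFrontier n e := by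
  induction n using Nat.strong_induction_on generalizing c with
  | _ n ih =>
  obtain ⟨I, hI, hsub⟩ := exists_finset_cellFrontier_subset n e
  set J : Set (Σ m, cell (univ : Set X) m) :=
    {d ∈ (I : Set (Σ m, cell (univ : Set X) m)) |
      d.1 + 1 = n ∧ ¬ Disjoint (openCell d.1 d.2) (cellFrontier n e)} with hJ
  set D : Set X := ⋃ d ∈ J, closedCell d.1 d.2 with hD
  have hJsub : ∀ d ∈ J, closedCell d.1 d.2 ⊆ cellFrontier n e := by
    rintro ⟨m, i⟩ ⟨-, rfl, hd⟩
    rw [← closure_openCell_eq_closedCell]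
    exact closure_minimal (openCell_subset_cellFrontier_of_succ hX e i hd) isClosed_cellFrontier
  have hDc : IsClosed D :=
    (I.finite_toSet.subset (sep_subset _ _)).isClosed_biUnion fun c _ => isClosed_closedCell
  -- The cells of codimension one cover the boundary: otherwise an open part of the boundary
  -- would embed in a cell of smaller dimension.
  have hcover : cellFrontier n e ⊆ D := by
    by_contra hne
    obtain ⟨x, hxe, hxD⟩ := not_subset.1 hne
    let T : Set (Σ m, cell (univ : Set X) m) :=
      {d ∈ (I : Set (Σ m, cell (univ : Set X) m)) |
        (openCell d.1 d.2 ∩ (cellFrontier n e \ D)).Nonempty}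
    have hT : T.Finite := I.finite_toSet.subset (sep_subset _ _)
    have hTne : T.Nonempty := by
      obtain ⟨d, hd, hxd⟩ := hsub x hxe
      exact ⟨d, hd, x, hxd, hxe, hxD⟩
    obtain ⟨d, hdT, hmax⟩ := hT.exists_maximalFor (fun d => d.1) T hTne
    obtain ⟨y, hyd, hye, hyD⟩ := hdT.2
    set Z : Set X := ⋃ b ∈ {b ∈ T | b ≠ d}, closedCell b.1 b.2 with hZ
    have hZc : IsClosed Z :=
      (hT.subset (sep_subset _ _)).isClosed_biUnion fun c _ => isClosed_closedCell
    have hdim := (isOpen_symm_image_cellFrontier hX e d.2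
      (hDc.isOpen_compl.inter hZc.isOpen_compl) ⟨y, hye, hyD, ?_⟩ ?_).1
    · have hd1 := hI d hdT.1
      have hdJ : d ∈ J := ⟨hdT.1, by omega, not_disjoint_iff.2 ⟨y, hyd, hye⟩⟩
      exact hyD (mem_biUnion hdJ (openCell_subset_closedCell _ _ hyd))
    · intro hyZ
      simp only [hZ, mem_iUnion] at hyZ
      obtain ⟨b, ⟨hbT, hbd⟩, hyb⟩ := hyZ
      have hbd' : b.1 ≤ d.1 := by
        rcases le_total b.1 d.1 with h | h
        · exact h
        · exact hmax hbT h
      exact disjoint_left.1 (disjoint_openCell_closedCell (Ne.symm hbd) hbd') hyd hyb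
    · rintro z ⟨hze, hzD, hzZ⟩
      obtain ⟨b, hb, hzb⟩ := hsub z hze
      by_cases hbd : b = d
      · rw [← hbd]; exact hzb
      · have hbT : b ∈ {b ∈ T | b ≠ d} := ⟨⟨hb, z, hzb, hze, hzD⟩, hbd⟩
        exact absurd (mem_biUnion hbT (openCell_subset_closedCell _ _ hzb)) hzZ
  obtain ⟨x, hxc, hxe⟩ := not_disjoint_iff.1 h
  have hxD := hcover hxe
  simp only [hD, mem_iUnion] at hxD
  obtain ⟨d, hdJ, hxd⟩ := hxD
  refine Subset.trans ?_ (hJsub d hdJ)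
  rw [← cellFrontier_union_openCell_eq_closedCell] at hxd
  rcases hxd with hxd | hxd
  · exact (ih d.1 (by have := hdJ.2.1; omega) d.2 c (not_disjoint_iff.2 ⟨x, hxc, hxd⟩)).trans
      (cellFrontier_subset_closedCell _ _)
  · have hcd : c = d := eq_of_not_disjoint_openCell (not_disjoint_iff.2 ⟨x, hxc, hxd⟩)
    rw [hcd]
    exact openCell_subset_closedCell _ _

end RegularCW

/-! ### The topology of geometric realizations -/

namespace PreAbstractSimplicialComplex

open Set Topology

namespace Realization

variable {V : Type u} {K : PreAbstractSimplicialComplex V}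

/-- The barycentric coordinates of a point of the realization. -/
def coords (x : K.Realization) : V →₀ ℝ := x.1

/-- The point of the realization with given barycentric coordinates. -/
def ofFinsupp (f : V →₀ ℝ) (h0 : ∀ v, 0 ≤ f v) (hf : f.support ∈ K.faces)
    (h1 : (f.sum fun _ r => r) = 1) : K.Realization := ⟨f, h0, hf, h1⟩

@[simp]
lemma coords_ofFinsupp (f : V →₀ ℝ) (h0 : ∀ v, 0 ≤ f v) (hf : f.support ∈ K.faces)
    (h1 : (f.sum fun _ r => r) = 1) : (ofFinsupp f h0 hf h1).coords = f := rfl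

lemma coords_nonneg (x : K.Realization) (v : V) : 0 ≤ x.coords v := x.2.1 v

lemma support_coords_mem (x : K.Realization) : x.coords.support ∈ K.faces := x.2.2.1

lemma sum_coords (x : K.Realization) : (x.coords.sum fun _ r => r) = 1 := x.2.2.2

lemma coords_injective : Function.Injective (coords : K.Realization → V →₀ ℝ) :=
  Subtype.val_injective

lemma continuous_coe_of_simplexTopology {s : Finset V} (hs : s ∈ K.faces) :
    @Continuous _ _ (simplexTopology K s) _ (Subtype.val : closedSimplex K s → K.Realization) :=
  continuous_iff_coinduced_le.2 (le_iSup (fun s : K.faces =>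
    TopologicalSpace.coinduced Subtype.val (simplexTopology K s.1)) ⟨s, hs⟩)

/-- A map out of a realization is continuous if its restrictions to all closed simplices are. -/
lemma continuous_of_continuousOn_closedSimplex {Y : Type*} [TopologicalSpace Y]
    {F : K.Realization → Y} (h : ∀ s ∈ K.faces, ContinuousOn F (closedSimplex K s)) :
    Continuous F := by
  refine continuous_iSup_dom.2 fun s => continuous_coinduced_dom.2 ?_
  let _ := simplexTopology K s.1
  have h1 := continuousOn_iff_continuous_domRestrict.1 (h s.1 s.2)
  have h2 : @Continuous _ _ (simplexTopology K s.1) instTopologicalSpaceSubtype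
      (id : closedSimplex K s.1 → closedSimplex K s.1) :=
    continuous_induced_rng.2 (continuous_coe_of_simplexTopology s.2)
  exact @Continuous.comp _ _ _ (simplexTopology K s.1) instTopologicalSpaceSubtype _
    id ((closedSimplex K s.1).domRestrict F) h1 h2

lemma continuous_coord : Continuous fun (x : K.Realization) (v : V) => x.coords v := by
  refine continuous_iSup_dom.2 fun s => continuous_coinduced_dom.2 ?_
  exact continuous_induced_dom

lemma continuous_coords_apply (v : V) : Continuous fun x : K.Realization => x.coords v :=
  (continuous_apply v).comp continuous_coord

lemma ext_apply {x y : K.Realization} (h : ∀ v, x.coords v = y.coords v) : x = y :=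
  coords_injective (Finsupp.ext h)

lemma injective_coord : Function.Injective fun (x : K.Realization) (v : V) => x.coords v :=
  fun _ _ h => ext_apply (congrFun h)

instance : T2Space K.Realization :=
  .of_injective_continuous injective_coord continuous_coord

lemma isCompact_closedSimplex {s : Finset V} (hs : s ∈ K.faces) :
    IsCompact (closedSimplex K s) := by
  classical
  let D : Set (V → ℝ) := {f | (∀ v, 0 ≤ f v) ∧ (∀ v ∉ s, f v = 0) ∧ ∑ v ∈ s, f v = 1}
  have hD : IsCompact D := by
    refine (isCompact_univ_pi fun _ => isCompact_Icc (a := (0 : ℝ)) (b := 1)).of_isClosed_subset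
      ?_ ?_
    · simp only [D, ofPred_and, ofPred_forall]
      refine (isClosed_iInter fun v => isClosed_le continuous_const (continuous_apply v)).inter
        ((isClosed_iInter fun v => isClosed_iInter fun _ =>
          isClosed_eq (continuous_apply v) continuous_const).inter
        (isClosed_eq (by fun_prop) continuous_const))
    · rintro f ⟨h0, hs0, h1⟩ v -
      refine ⟨h0 v, ?_⟩
      by_cases hv : v ∈ s
      · rw [← h1]; exact Finset.single_le_sum (fun w _ => h0 w) hv
      · rw [hs0 v hv]; exact zero_le_one
  have hsub : ∀ f : D, ∀ v, f.1 v ≠ 0 → v ∈ s := fun f v hv => by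
    by_contra h; exact hv (f.2.2.1 v h)
  let φ : D → closedSimplex K s := fun f =>
    ⟨ofFinsupp (Finsupp.onFinset s f.1 (hsub f)) f.2.1 (by
      have h1 : (Finsupp.onFinset s f.1 (hsub f)).support ⊆ s := Finsupp.support_onFinset_subset
      refine (K.isRelLowerSet_faces hs).2 h1 ?_
      by_contra hne
      rw [Finset.not_nonempty_iff_eq_empty, Finsupp.support_eq_empty] at hne
      have h2 : ∀ v, f.1 v = 0 := fun v => DFunLike.congr_fun hne v
      simpa [h2] using f.2.2.2) (by
      rw [Finsupp.onFinset_sum _ fun _ => rfl]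
      exact f.2.2.2), Finsupp.support_onFinset_subset (hf := hsub f)⟩
  have hφ : Continuous fun f : D => (φ f).1 := by
    let _ := simplexTopology K s
    have : @Continuous _ _ _ (simplexTopology K s) φ := continuous_induced_rng.2
      continuous_subtype_val
    exact @Continuous.comp _ _ _ _ (simplexTopology K s) _ _ _
      (continuous_coe_of_simplexTopology hs) this
  have : CompactSpace D := isCompact_iff_compactSpace.1 hD
  convert isCompact_range hφ
  ext x
  constructor
  · intro hx
    have hx' : x.coords.support ⊆ s := hx
    refine ⟨⟨fun v => x.coords v, x.coords_nonneg, fun v hv => ?_, ?_⟩, ?_⟩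
    · by_contra h; exact hv (hx' (Finsupp.mem_support_iff.2 h))
    · rw [← x.sum_coords, Finsupp.sum_of_support_subset _ hx' _ fun _ _ => rfl]
    · exact ext_apply fun v => rfl
  · rintro ⟨f, rfl⟩
    exact (φ f).2

/-- The points supported in a finite set of vertices form a finite subcomplex. -/
lemma isCompact_support_subset (T : Finset V) :
    IsCompact {x : K.Realization | x.coords.support ⊆ T} := by
  classical
  have : {x : K.Realization | x.coords.support ⊆ T} =
      ⋃ s ∈ {s | s ∈ T.powerset ∧ s ∈ K.faces}, closedSimplex K s := by
    ext x
    simp only [mem_ofPred_eq, mem_iUnion, Finset.mem_powerset, exists_prop]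
    exact ⟨fun h => ⟨x.coords.support, ⟨h, x.2.2.1⟩, Finset.Subset.refl _⟩,
      fun ⟨s, hs, hx⟩ => Finset.Subset.trans hx hs.1⟩
  rw [this]
  exact (T.powerset.finite_toSet.subset fun s hs => hs.1).isCompact_biUnion
    fun s hs => isCompact_closedSimplex hs.2

lemma compactSpace_of_finite [Finite V] : CompactSpace K.Realization := by
  have := Fintype.ofFinite V
  refine ⟨?_⟩
  convert isCompact_support_subset (K := K) Finset.univ
  ext x
  simp

/-- A map to a finite subcomplex is continuous if its barycentric coordinates are. -/
lemma continuous_of_continuous_coords {Y : Type*} [TopologicalSpace Y] {F : Y → K.Realization}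
    (T : Finset V) (hT : ∀ y, (F y).coords.support ⊆ T)
    (h : ∀ v ∈ T, Continuous fun y => (F y).coords v) : Continuous F := by
  let A := {x : K.Realization | x.coords.support ⊆ T}
  have : CompactSpace A := isCompact_iff_compactSpace.1 (isCompact_support_subset T)
  have hemb : IsClosedEmbedding fun (x : A) (v : V) => x.1.coords v :=
    (continuous_coord.comp continuous_subtype_val).isClosedEmbedding
      (injective_coord.comp Subtype.val_injective)
  have : Continuous fun y => (⟨F y, hT y⟩ : A) := by
    rw [hemb.isEmbedding.continuous_iff]
    refine continuous_pi fun v => ?_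
    by_cases hv : v ∈ T
    · exact h v hv
    · have : ∀ y, (F y).coords v = 0 := fun y => by
        by_contra hne; exact hv (hT y (Finsupp.mem_support_iff.2 hne))
      simpa [this] using continuous_const
  exact continuous_subtype_val.comp this

end Realization

open Realization

/-- The realization of a finite complex is homeomorphic to that of an isomorphic full subcomplex of
a complex `K`. -/
lemma nonempty_homeomorph_support_subset {V W : Type u} [Finite W]
    (K : PreAbstractSimplicialComplex V) (L : PreAbstractSimplicialComplex W) (e : W ↪ V)
    (h : ∀ τ : Finset W, τ ∈ L.faces ↔ τ.map e ∈ K.faces) :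
    Nonempty (L.Realization ≃ₜ {x : K.Realization | (x.coords.support : Set V) ⊆ range e}) := by
  classical
  have := Fintype.ofFinite W
  have : CompactSpace L.Realization := compactSpace_of_finite
  let F : L.Realization → {x : K.Realization | (x.coords.support : Set V) ⊆ range e} := fun x =>
    ⟨ofFinsupp (x.coords.embDomain e) (fun v => by
      by_cases hv : v ∈ range e
      · obtain ⟨w, rfl⟩ := hv
        rw [Finsupp.embDomain_apply_self]
        exact x.coords_nonneg w
      · rw [Finsupp.embDomain_of_notMem_range _ _ _ hv]) (by
      rw [Finsupp.support_embDomain]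
      exact (h _).1 x.support_coords_mem) (by
      rw [Finsupp.sum_embDomain]
      exact x.sum_coords), by
      simp [Finsupp.support_embDomain]⟩
  have hF : Continuous F := by
    refine Continuous.subtype_mk (continuous_of_continuous_coords (Finset.univ.map e) ?_ ?_) _
    · intro x v
      simp only [coords_ofFinsupp, Finsupp.support_embDomain, Finset.mem_map, Finset.mem_univ,
        true_and]
      exact fun ⟨w, _, hw⟩ => ⟨w, hw⟩
    · intro v hv
      obtain ⟨w, -, rfl⟩ := Finset.mem_map.1 hv
      simpa [Finsupp.embDomain_apply_self] using continuous_coords_apply w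
  have hbij : Function.Bijective F := by
    constructor
    · intro x y hxy
      exact coords_injective (Finsupp.embDomain_injective e
        (congrArg (fun z => z.1.coords) hxy))
    · rintro ⟨y, hy⟩
      have hmap : (y.coords.comapDomain e e.injective.injOn).embDomain e = y.coords :=
        Finsupp.embDomain_comapDomain hy
      refine ⟨ofFinsupp (y.coords.comapDomain e e.injective.injOn) (fun w => y.coords_nonneg _)
        ?_ ?_, ?_⟩
      · rw [h, ← Finsupp.support_embDomain, hmap]
        exact y.support_coords_mem
      · refine (Finsupp.sum_embDomain (f := e) (g := fun _ r => r)).symm.trans ?_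
        rw [hmap]
        exact y.sum_coords
      · exact Subtype.ext (coords_injective hmap)
  exact ⟨Continuous.homeoOfEquivCompactToT2 (f := Equiv.ofBijective F hbij) hF⟩

end PreAbstractSimplicialComplex

namespace PreAbstractSimplicialComplex.Realization

open Set

variable {V : Type u} {K : PreAbstractSimplicialComplex V}

lemma sum_smul_coords (c : ℝ) (f : V →₀ ℝ) :
    ((c • f).sum fun _ r => r) = c * f.sum fun _ r => r := by
  rw [Finsupp.sum_smul_index fun _ => rfl, Finsupp.mul_sum]

lemma coords_add_sum_erase (f : V →₀ ℝ) (v : V) :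
    f v + ((f.erase v).sum fun _ r => r) = f.sum fun _ r => r := by
  conv_rhs => rw [← Finsupp.single_add_erase v f]
  rw [Finsupp.sum_add_index' (fun _ => rfl) fun _ _ _ => rfl, Finsupp.sum_single_index rfl]

lemma sum_erase_coords (x : K.Realization) (v : V) :
    ((x.coords.erase v).sum fun _ r => r) = 1 - x.coords v := by
  have := coords_add_sum_erase x.coords v
  rw [x.sum_coords] at this
  linarith

lemma coords_le_one (x : K.Realization) (v : V) : x.coords v ≤ 1 := by
  have h := x.sum_erase_coords v
  have : 0 ≤ (x.coords.erase v).sum fun _ r => r := Finset.sum_nonneg fun w _ => by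
    classical
    rw [Finsupp.erase_apply]
    split_ifs
    · exact le_rfl
    · exact x.coords_nonneg w
  linarith

lemma coords_eq_single (x : K.Realization) {v : V} (h : x.coords v = 1) :
    x.coords = Finsupp.single v 1 := by
  classical
  have h0 := x.sum_erase_coords v
  rw [h, sub_self] at h0
  have h1 : x.coords.erase v = 0 := by
    ext w
    by_contra hw
    refine (Finset.sum_pos' (fun w _ => ?_) ⟨w, Finsupp.mem_support_iff.2 hw,
      lt_of_le_of_ne ?_ (Ne.symm hw)⟩).ne' h0
    all_goals
      rw [Finsupp.erase_apply]
      split_ifs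
      · exact le_rfl
      · exact x.coords_nonneg w
  rw [← Finsupp.single_add_erase v x.coords, h, h1, add_zero]

/-- The barycentric coordinates of the projection of a point from the vertex `v`. For the vertex
`v` itself, where the projection is undefined, the value is `0`. -/
noncomputable def projCoords (v : V) (f : V →₀ ℝ) : V →₀ ℝ := (1 - f v)⁻¹ • f.erase v

lemma support_projCoords {v : V} {f : V →₀ ℝ} [DecidableEq V] (h : f v < 1) :
    (projCoords v f).support = f.support.erase v := by
  rw [projCoords, Finsupp.support_smul_eq (inv_ne_zero (sub_pos.2 h).ne')]
  ext w
  simp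

lemma projCoords_of_eq_zero {v : V} {f : V →₀ ℝ} (h : f v = 0) : projCoords v f = f := by
  rw [projCoords, h, Finsupp.erase_of_notMem_support (by simpa using h)]
  simp

/-- The projection of a point from the vertex `v` to the opposite face. -/
noncomputable def proj (x : K.Realization) (v : V) (h : x.coords v < 1) : K.Realization :=
  ofFinsupp (projCoords v x.coords) (fun w => by
    classical
    have := sub_pos.2 h
    rw [projCoords, Finsupp.smul_apply, Finsupp.erase_apply, smul_eq_mul]
    split_ifs
    · simp
    · exact mul_nonneg (by positivity) (x.coords_nonneg w))
  (by
    classical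
    rw [support_projCoords h]
    refine (K.isRelLowerSet_faces x.support_coords_mem).2 (Finset.erase_subset _ _) ?_
    rw [← support_projCoords h]
    by_contra hne
    rw [Finset.not_nonempty_iff_eq_empty, Finsupp.support_eq_empty] at hne
    have h1 := sum_smul_coords (1 - x.coords v)⁻¹ (x.coords.erase v)
    rw [sum_erase_coords, inv_mul_cancel₀ (sub_pos.2 h).ne'] at h1
    rw [projCoords] at hne
    rw [hne] at h1
    simp at h1)
  (by rw [projCoords, sum_smul_coords, sum_erase_coords, inv_mul_cancel₀ (sub_pos.2 h).ne'])

@[simp]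
lemma coords_proj (x : K.Realization) (v : V) (h : x.coords v < 1) :
    (x.proj v h).coords = projCoords v x.coords := rfl

lemma ext_of_projCoords {x y : K.Realization} {v : V} (h : x.coords v = y.coords v)
    (hp : projCoords v x.coords = projCoords v y.coords) : x = y := by
  apply coords_injective
  rcases (x.coords_le_one v).lt_or_eq with h1 | h1
  · rw [projCoords, projCoords, ← h] at hp
    have := smul_right_injective (V →₀ ℝ) (inv_ne_zero (sub_pos.2 h1).ne') hp
    rw [← Finsupp.single_add_erase v x.coords, ← Finsupp.single_add_erase v y.coords, h, this]
  · rw [x.coords_eq_single h1, y.coords_eq_single (h ▸ h1)]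

end PreAbstractSimplicialComplex.Realization

lemma IsCompact.continuousOn_invFunOn {Y X : Type*} [TopologicalSpace Y] [TopologicalSpace X]
    [T2Space X] [Nonempty Y] {f : Y → X} {s : Set Y} (hs : IsCompact s) (hf : ContinuousOn f s)
    (hinj : Set.InjOn f s) : ContinuousOn (Function.invFunOn f s) (f '' s) := by
  have : CompactSpace s := isCompact_iff_compactSpace.1 hs
  have hemb := (continuousOn_iff_continuous_domRestrict.1 hf).isClosedEmbedding
    (Set.injOn_iff_injective.1 hinj)
  rw [continuousOn_iff_continuous_domRestrict]
  have : Continuous fun p : f '' s =>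
      (⟨Function.invFunOn f s p, Function.invFunOn_mem p.2⟩ : s) := by
    rw [hemb.isEmbedding.continuous_iff]
    convert continuous_subtype_val using 1
    funext p
    exact Function.invFunOn_eq p.2
  exact continuous_subtype_val.comp this

/-! ### Barycentric subdivision of regular cell decompositions -/

section OrderComplex

open PreAbstractSimplicialComplex

variable {Q : Type u} [PartialOrder Q]

lemma exists_greatest_of_mem_faces {s : Finset Q} (hs : s ∈ (orderComplex Q).faces) :
    ∃ e ∈ s, ∀ z ∈ s, z ≤ e := by
  obtain ⟨e, he⟩ := s.exists_maximal hs.1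
  refine ⟨e, he.1, fun z hz => ?_⟩
  rcases hs.2.total hz he.1 with h | h
  · exact h
  · exact he.2 hz h

namespace PreAbstractSimplicialComplex.Realization

/-- The point of the realization of an order complex corresponding to an element of the poset. -/
noncomputable def vertex (e : Q) : (orderComplex Q).Realization :=
  ofFinsupp (Finsupp.single e 1)
    (fun v => by classical rw [Finsupp.single_apply]; split_ifs <;> norm_num)
    (by rw [Finsupp.support_single _ one_ne_zero]; exact ⟨by simp, by simp⟩)
    (Finsupp.sum_single_index rfl)

@[simp]
lemma coords_vertex (e : Q) : (vertex e).coords = Finsupp.single e 1 := rfl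

lemma eq_of_mem_support_vertex {e z : Q} (hz : z ∈ (vertex e).coords.support) : z = e := by
  rwa [coords_vertex, Finsupp.support_single _ one_ne_zero, Finset.mem_singleton] at hz

/-- The point whose barycentric coordinates are `f` below `e` and the remaining weight at `e`. -/
noncomputable def cone (e : Q) (f : Q →₀ ℝ) (h0 : ∀ v, 0 ≤ f v) (hlt : ∀ z ∈ f.support, z < e)
    (hch : IsChain (· ≤ ·) (f.support : Set Q)) (h1 : (f.sum fun _ r => r) ≤ 1) :
    (orderComplex Q).Realization :=
  have hsum : ((Finsupp.single e (1 - f.sum fun _ r => r) + f).sum fun _ r => r) = 1 := by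
    rw [Finsupp.sum_add_index' (fun _ => rfl) fun _ _ _ => rfl, Finsupp.sum_single_index rfl,
      sub_add_cancel]
  ofFinsupp (Finsupp.single e (1 - f.sum fun _ r => r) + f)
    (fun v => by
      classical
      rw [Finsupp.add_apply, Finsupp.single_apply]
      have := h0 v
      split_ifs <;> linarith)
    (by
      classical
      have hface : insert e f.support ∈ (orderComplex Q).faces := by
        refine ⟨Finset.insert_nonempty _ _, ?_⟩
        rw [Finset.coe_insert]
        exact hch.insert fun z hz _ => Or.inr (hlt z hz).le
      refine ((orderComplex Q).isRelLowerSet_faces hface).2 (fun z hz => ?_) ?_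
      · rcases Finset.mem_union.1 (Finsupp.support_add hz) with h | h
        · exact Finset.mem_insert.2
            (Or.inl (Finset.mem_singleton.1 (Finsupp.support_single_subset h)))
        · exact Finset.mem_insert_of_mem h
      · by_contra hne
        rw [Finset.not_nonempty_iff_eq_empty, Finsupp.support_eq_empty] at hne
        rw [hne] at hsum
        simp at hsum)
    hsum

section cone

variable {e : Q} {f : Q →₀ ℝ} {h0 : ∀ v, 0 ≤ f v} {hlt : ∀ z ∈ f.support, z < e}
  {hch : IsChain (· ≤ ·) (f.support : Set Q)} {h1 : (f.sum fun _ r => r) ≤ 1}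

lemma apex_eq_zero (hlt : ∀ z ∈ f.support, z < e) : f e = 0 := by
  by_contra h
  exact lt_irrefl e (hlt e (Finsupp.mem_support_iff.2 h))

lemma coords_cone_apex : (cone e f h0 hlt hch h1).coords e = 1 - f.sum fun _ r => r := by
  simp [cone, apex_eq_zero hlt]

lemma coords_cone_of_ne {v : Q} (hv : v ≠ e) : (cone e f h0 hlt hch h1).coords v = f v := by
  simp [cone, hv]

lemma erase_coords_cone : (cone e f h0 hlt hch h1).coords.erase e = f := by
  ext v
  rcases eq_or_ne v e with rfl | hv
  · rw [Finsupp.erase_same, apex_eq_zero hlt]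
  · rw [Finsupp.erase_ne hv, coords_cone_of_ne hv]

lemma le_of_mem_support_cone {z : Q} (hz : z ∈ (cone e f h0 hlt hch h1).coords.support) :
    z ≤ e := by
  rcases eq_or_ne z e with rfl | hne
  · exact le_rfl
  · rw [Finsupp.mem_support_iff, coords_cone_of_ne hne] at hz
    exact (hlt z (Finsupp.mem_support_iff.2 hz)).le

lemma projCoords_cone :
    projCoords e (cone e f h0 hlt hch h1).coords = (f.sum fun _ r => r)⁻¹ • f := by
  rw [projCoords, coords_cone_apex, sub_sub_cancel, erase_coords_cone]

end cone

end PreAbstractSimplicialComplex.Realization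

end OrderComplex

open PreAbstractSimplicialComplex in
/-- A decomposition of a space into cells indexed by a poset such that every closed cell is an
embedded ball whose boundary sphere is the union of the open cells below it. -/
structure RegularCells (Q : Type u) [PartialOrder Q] (X : Type u) [TopologicalSpace X] where
  /-- The dimension of a cell. -/
  dim : Q → ℕ
  /-- The characteristic map of a cell. -/
  char : ∀ q, (Fin (dim q) → ℝ) → X
  continuousOn_char : ∀ q, ContinuousOn (char q) (Metric.closedBall 0 1)
  injOn_char : ∀ q, Set.InjOn (char q) (Metric.closedBall 0 1)
  disjoint : ∀ q r, q ≠ r →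
    Disjoint (char q '' Metric.ball 0 1) (char r '' Metric.ball 0 1)
  image_sphere : ∀ q, char q '' Metric.sphere 0 1 = ⋃ r < q, char r '' Metric.ball 0 1
  finite_Iio : ∀ q : Q, (Set.Iio q).Finite

namespace RegularCells

open Metric Set PreAbstractSimplicialComplex PreAbstractSimplicialComplex.Realization

variable {Q : Type u} [PartialOrder Q] {X : Type u} [TopologicalSpace X] (R : RegularCells Q X)

/-- The inverse of the characteristic map of a cell, with arbitrary values outside the closed
cell. -/
noncomputable def inv (q : Q) : X → Fin (R.dim q) → ℝ :=
  Function.invFunOn (R.char q) (closedBall 0 1)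

lemma inv_char {q : Q} {y : Fin (R.dim q) → ℝ} (hy : y ∈ closedBall 0 1) :
    R.inv q (R.char q y) = y :=
  (R.injOn_char q).leftInvOn_invFunOn hy

lemma char_inv {q : Q} {p : X} (hp : p ∈ R.char q '' closedBall 0 1) :
    R.char q (R.inv q p) = p :=
  Function.invFunOn_eq hp

lemma inv_mem_sphere {q : Q} {p : X} (hp : p ∈ R.char q '' sphere 0 1) :
    R.inv q p ∈ sphere 0 1 := by
  obtain ⟨y, hy, rfl⟩ := hp
  rwa [R.inv_char (sphere_subset_closedBall hy)]

lemma continuousOn_inv [T2Space X] (q : Q) :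
    ContinuousOn (R.inv q) (R.char q '' closedBall 0 1) :=
  (isCompact_closedBall _ _).continuousOn_invFunOn (R.continuousOn_char q) (R.injOn_char q)

lemma image_ball_subset_sphere {q r : Q} (h : r < q) :
    R.char r '' ball 0 1 ⊆ R.char q '' sphere 0 1 := by
  rw [R.image_sphere]
  exact subset_biUnion_of_mem (u := fun r => R.char r '' ball 0 1) (show r ∈ {r | r < q} from h)

open Classical in
/-- The barycentric parametrization: the point with largest vertex `e`, weight `t` at `e`, and
remaining vertices describing a point `p` of the boundary of `e`, is sent to the point dividing the
segment from the centre of `e` to `p` in the ratio given by `t`. -/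
noncomputable def param [Nonempty X] (f : Q →₀ ℝ) : X :=
  if h : ∃ e ∈ f.support, ∀ z ∈ f.support, z ≤ e then
    R.char h.choose
      ((1 - f h.choose) • R.inv h.choose (param ((1 - f h.choose)⁻¹ • f.erase h.choose)))
  else Classical.arbitrary X
termination_by f.support.card
decreasing_by
  refine (Finset.card_le_card fun z hz => ?_).trans_lt
    (Finset.card_erase_lt_of_mem h.choose_spec.1)
  simpa using Finsupp.support_smul hz

variable [Nonempty X]

lemma param_eq_of_mem {f : Q →₀ ℝ} {e : Q} (he : e ∈ f.support) (hmax : ∀ z ∈ f.support, z ≤ e) :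
    R.param f = R.char e ((1 - f e) • R.inv e (R.param (projCoords e f))) := by
  have h : ∃ e ∈ f.support, ∀ z ∈ f.support, z ≤ e := ⟨e, he, hmax⟩
  have hch : h.choose = e := le_antisymm (hmax _ h.choose_spec.1) (h.choose_spec.2 _ he)
  rw [param, dif_pos h]
  simp only [projCoords]
  rw [hch]

lemma param_mem_ball_and_param_mem_sphere (n : ℕ) :
    ∀ x : (orderComplex Q).Realization, x.coords.support.card = n →
      (∀ e ∈ x.coords.support, (∀ z ∈ x.coords.support, z ≤ e) →
        R.param x.coords ∈ R.char e '' ball 0 1) ∧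
      ∀ e, (∀ z ∈ x.coords.support, z < e) → R.param x.coords ∈ R.char e '' sphere 0 1 := by
  classical
  induction n using Nat.strong_induction_on with
  | _ n ih =>
  intro x hx
  have h1 : ∀ e ∈ x.coords.support, (∀ z ∈ x.coords.support, z ≤ e) →
      R.param x.coords ∈ R.char e '' ball 0 1 := by
    intro e he hmax
    rw [R.param_eq_of_mem he hmax]
    refine mem_image_of_mem _ ?_
    rcases (x.coords_le_one e).lt_or_eq with ht | ht
    · have hsup : (x.proj e ht).coords.support = x.coords.support.erase e := support_projCoords ht
      have hcard : (x.proj e ht).coords.support.card < n := by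
        rw [hsup, ← hx]
        exact Finset.card_erase_lt_of_mem he
      have hs := (ih _ hcard (x.proj e ht) rfl).2 e (fun z hz => by
        rw [hsup, Finset.mem_erase] at hz
        exact lt_of_le_of_ne (hmax z hz.2) hz.1)
      have hn := mem_sphere_zero_iff_norm.1 (R.inv_mem_sphere hs)
      rw [coords_proj] at hn
      have hpos : 0 < x.coords e := lt_of_le_of_ne (x.coords_nonneg e)
        (Ne.symm (Finsupp.mem_support_iff.1 he))
      rw [mem_ball_zero_iff, norm_smul, hn, mul_one, Real.norm_of_nonneg (by linarith)]
      linarith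
    · simp [ht]
  refine ⟨h1, fun e he => ?_⟩
  obtain ⟨d, hd, hmax⟩ := exists_greatest_of_mem_faces x.support_coords_mem
  exact R.image_ball_subset_sphere (he d hd) (h1 d hd hmax)

lemma param_mem_ball (x : (orderComplex Q).Realization) {e : Q} (he : e ∈ x.coords.support)
    (hmax : ∀ z ∈ x.coords.support, z ≤ e) : R.param x.coords ∈ R.char e '' ball 0 1 :=
  (R.param_mem_ball_and_param_mem_sphere _ x rfl).1 e he hmax

lemma param_mem_sphere (x : (orderComplex Q).Realization) {e : Q}
    (he : ∀ z ∈ x.coords.support, z < e) : R.param x.coords ∈ R.char e '' sphere 0 1 :=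
  (R.param_mem_ball_and_param_mem_sphere _ x rfl).2 e he

lemma param_proj_mem_sphere (x : (orderComplex Q).Realization) {e : Q}
    (hmax : ∀ z ∈ x.coords.support, z ≤ e) (ht : x.coords e < 1) :
    R.param (projCoords e x.coords) ∈ R.char e '' sphere 0 1 := by
  classical
  refine R.param_mem_sphere (x.proj e ht) fun z hz => ?_
  rw [coords_proj, support_projCoords ht, Finset.mem_erase] at hz
  exact lt_of_le_of_ne (hmax z hz.2) hz.1

/-- The recursion formula for the parametrization holds for any upper bound of the vertices. -/
lemma param_eq (x : (orderComplex Q).Realization) {e : Q}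
    (hmax : ∀ z ∈ x.coords.support, z ≤ e) :
    R.param x.coords =
      R.char e ((1 - x.coords e) • R.inv e (R.param (projCoords e x.coords))) := by
  by_cases he : e ∈ x.coords.support
  · exact R.param_eq_of_mem he hmax
  · have h0 : x.coords e = 0 := by simpa using he
    rw [projCoords_of_eq_zero h0, h0, sub_zero, one_smul, R.char_inv]
    refine image_mono sphere_subset_closedBall (R.param_mem_sphere x fun z hz => ?_)
    exact lt_of_le_of_ne (hmax z hz) fun h => he (h ▸ hz)

lemma norm_param_arg (x : (orderComplex Q).Realization) {e : Q}
    (hmax : ∀ z ∈ x.coords.support, z ≤ e) :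
    ‖(1 - x.coords e) • R.inv e (R.param (projCoords e x.coords))‖ = 1 - x.coords e := by
  rcases (x.coords_le_one e).lt_or_eq with ht | ht
  · have hn := mem_sphere_zero_iff_norm.1 (R.inv_mem_sphere (R.param_proj_mem_sphere x hmax ht))
    rw [norm_smul, hn, mul_one, Real.norm_of_nonneg (by linarith)]
  · simp [ht]

lemma param_injective :
    Function.Injective fun x : (orderComplex Q).Realization => R.param x.coords := by
  classical
  suffices h : ∀ n : ℕ, ∀ x y : (orderComplex Q).Realization, x.coords.support.card = n →
      R.param x.coords = R.param y.coords → x = y from fun x y hxy => h _ x y rfl hxy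
  intro n
  induction n using Nat.strong_induction_on with
  | _ n ih =>
  intro x y hx hxy
  obtain ⟨e, he, hmax⟩ := exists_greatest_of_mem_faces x.support_coords_mem
  obtain ⟨d, hd, hmax'⟩ := exists_greatest_of_mem_faces y.support_coords_mem
  have hed : e = d := by
    by_contra hne
    exact disjoint_left.1 (R.disjoint e d hne) (R.param_mem_ball x he hmax)
      (hxy ▸ R.param_mem_ball y hd hmax')
  subst hed
  have hnx := R.norm_param_arg x hmax
  have hny := R.norm_param_arg y hmax'
  have hcx := x.coords_nonneg e
  have hcy := y.coords_nonneg e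
  rw [R.param_eq x hmax, R.param_eq y hmax'] at hxy
  have harg := R.injOn_char e (by rw [mem_closedBall_zero_iff, hnx]; linarith)
    (by rw [mem_closedBall_zero_iff, hny]; linarith) hxy
  have ht : x.coords e = y.coords e := by rw [harg, hny] at hnx; linarith
  refine ext_of_projCoords ht ?_
  rcases (x.coords_le_one e).lt_or_eq with h1 | h1
  · have h1' : y.coords e < 1 := ht ▸ h1
    rw [← ht] at harg
    have hinv := smul_right_injective _ (sub_pos.2 h1).ne' harg
    have hp : R.param (projCoords e x.coords) = R.param (projCoords e y.coords) := by
      rw [← R.char_inv (image_mono sphere_subset_closedBall (R.param_proj_mem_sphere x hmax h1)),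
        ← R.char_inv (image_mono sphere_subset_closedBall (R.param_proj_mem_sphere y hmax' h1')),
        hinv]
    have hcard : (x.proj e h1).coords.support.card < n := by
      rw [coords_proj, support_projCoords h1, ← hx]
      exact Finset.card_erase_lt_of_mem he
    exact congrArg coords (ih _ hcard (x.proj e h1) (y.proj e h1') rfl hp)
  · rw [x.coords_eq_single h1, y.coords_eq_single (ht ▸ h1)]

lemma exists_param_eq (e : Q) (p : X) (hp : p ∈ R.char e '' closedBall 0 1) :
    ∃ x : (orderComplex Q).Realization, (∀ z ∈ x.coords.support, z ≤ e) ∧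
      R.param x.coords = p := by
  classical
  suffices h : ∀ n : ℕ, ∀ e : Q, (Iio e).ncard = n → ∀ p ∈ R.char e '' closedBall 0 1,
      ∃ x : (orderComplex Q).Realization, (∀ z ∈ x.coords.support, z ≤ e) ∧
        R.param x.coords = p from h _ e rfl p hp
  intro n
  induction n using Nat.strong_induction_on with
  | _ n ih =>
  rintro e hn _ ⟨y, hy, rfl⟩
  have hy1 := mem_closedBall_zero_iff.1 hy
  rcases eq_or_ne y 0 with rfl | hy0
  · have hmax : ∀ z ∈ (vertex e).coords.support, z ≤ e := fun z hz =>
      (eq_of_mem_support_vertex hz).le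
    refine ⟨vertex e, hmax, ?_⟩
    rw [R.param_eq _ hmax]
    simp
  · have hρ : 0 < ‖y‖ := norm_pos_iff.2 hy0
    have hu : ‖y‖⁻¹ • y ∈ sphere (0 : Fin (R.dim e) → ℝ) 1 := by
      rw [mem_sphere_zero_iff_norm, norm_smul, norm_inv, norm_norm, inv_mul_cancel₀ hρ.ne']
    have hpu := mem_image_of_mem (R.char e) hu
    rw [R.image_sphere] at hpu
    simp only [mem_iUnion] at hpu
    obtain ⟨d, hde, hd⟩ := hpu
    have hcard : (Iio d).ncard < n := by
      rw [← hn]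
      exact ncard_lt_ncard ⟨fun z hz => lt_trans hz hde, fun h => lt_irrefl d (h hde)⟩
        (R.finite_Iio e)
    obtain ⟨g, hg, hgp⟩ := ih _ hcard d rfl _ (image_mono ball_subset_closedBall hd)
    have hsupp : (‖y‖ • g.coords).support = g.coords.support := Finsupp.support_smul_eq hρ.ne'
    have hsum : ((‖y‖ • g.coords).sum fun _ r => r) = ‖y‖ := by
      rw [sum_smul_coords, sum_coords, mul_one]
    let x := cone e (‖y‖ • g.coords) (fun v => mul_nonneg hρ.le (g.coords_nonneg v))
      (fun z hz => (hg z (hsupp ▸ hz)).trans_lt hde) (hsupp ▸ g.support_coords_mem.2)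
      (hsum.trans_le hy1)
    have hmax : ∀ z ∈ x.coords.support, z ≤ e := fun z hz => le_of_mem_support_cone hz
    refine ⟨x, hmax, ?_⟩
    have hxp : projCoords e x.coords = _ := projCoords_cone
    have hxe : x.coords e = _ := coords_cone_apex
    rw [R.param_eq _ hmax, hxp, hxe, hsum, smul_smul, inv_mul_cancel₀ hρ.ne', one_smul, hgp,
      R.inv_char (sphere_subset_closedBall hu),
      sub_sub_cancel, smul_smul, mul_inv_cancel₀ hρ.ne', one_smul]

variable [T2Space X]

/-- Continuity on the simplex with largest vertex `e`: away from `e` this is clear by induction,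
and near `e` the argument of the characteristic map tends to `0`. -/
lemma continuousOn_param_closedSimplex (s : Finset Q) (hs : s ∈ (orderComplex Q).faces) :
    ContinuousOn (fun x : (orderComplex Q).Realization => R.param x.coords)
      (closedSimplex _ s) := by
  classical
  induction s using Finset.strongInduction with
  | _ s ih =>
  obtain ⟨e, he, hmax⟩ := exists_greatest_of_mem_faces hs
  have hmax' : ∀ x ∈ closedSimplex (orderComplex Q) s, ∀ z ∈ x.coords.support, z ≤ e :=
    fun x hx z hz => hmax z (hx hz)
  let y : (orderComplex Q).Realization → Fin (R.dim e) → ℝ := fun x =>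
    (1 - x.coords e) • R.inv e (R.param (projCoords e x.coords))
  have hy : ∀ x ∈ closedSimplex (orderComplex Q) s, y x ∈ closedBall 0 1 := fun x hx => by
    rw [mem_closedBall_zero_iff, R.norm_param_arg x (hmax' x hx)]
    linarith [x.coords_nonneg e]
  suffices hyc : ContinuousOn y (closedSimplex (orderComplex Q) s) by
    refine ((R.continuousOn_char e).comp hyc hy).congr fun x hx => ?_
    exact R.param_eq x (hmax' x hx)
  have hce : Continuous fun x : (orderComplex Q).Realization => x.coords e :=
    continuous_coords_apply e
  have hce1 : Continuous fun x : (orderComplex Q).Realization => 1 - x.coords e :=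
    continuous_const.sub hce
  have hU : IsOpen {x : (orderComplex Q).Realization | x.coords e < 1} :=
    isOpen_lt hce continuous_const
  let A := closedSimplex (orderComplex Q) s ∩ {x | x.coords e < 1}
  have hA : ContinuousOn y A := by
    refine hce1.continuousOn.smul ((R.continuousOn_inv e).comp
      (f := fun x : (orderComplex Q).Realization => R.param (projCoords e x.coords)) ?_
      fun x hx => image_mono sphere_subset_closedBall
        (R.param_proj_mem_sphere x (hmax' x hx.1) hx.2))
    rw [continuousOn_iff_continuous_domRestrict]
    let p : A → (orderComplex Q).Realization := fun x => x.1.proj e x.2.2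
    have hps : ∀ x : A, (p x).coords.support ⊆ s.erase e := fun x => by
      rw [coords_proj, support_projCoords x.2.2]
      exact Finset.erase_subset_erase e x.2.1
    have hp : Continuous p := by
      refine continuous_of_continuous_coords (s.erase e) hps fun v hv => ?_
      have hve : v ≠ e := Finset.ne_of_mem_erase hv
      simp only [p, coords_proj, projCoords, Finsupp.smul_apply, Finsupp.erase_ne hve, smul_eq_mul]
      refine Continuous.mul (Continuous.inv₀ ?_ fun x => (sub_pos.2 x.2.2).ne') ?_
      · exact continuous_const.sub (hce.comp continuous_subtype_val)
      · exact (continuous_coords_apply v).comp continuous_subtype_val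
    rcases isEmpty_or_nonempty A with hAe | ⟨⟨a⟩⟩
    · exact continuous_of_const fun x => (hAe.false x).elim
    · have hface : s.erase e ∈ (orderComplex Q).faces :=
        ((orderComplex Q).isRelLowerSet_faces hs).2 (Finset.erase_subset _ _)
          ((p a).support_coords_mem.1.mono (hps a))
      exact (ih _ (Finset.erase_ssubset he) hface).comp_continuous hp hps
  intro x hx
  rcases (x.coords_le_one e).lt_or_eq with h1 | h1
  · exact ((hA x ⟨hx, h1⟩).mono_of_mem_nhdsWithin
      (inter_mem_nhdsWithin _ (hU.mem_nhds h1)))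
  · have hyx : y x = 0 := by simp [y, h1]
    rw [ContinuousWithinAt, hyx]
    have hlim : Filter.Tendsto (fun x : (orderComplex Q).Realization => 1 - x.coords e)
        (nhdsWithin x (closedSimplex _ s)) (nhds 0) := by
      have := hce1.tendsto x
      rw [h1, sub_self] at this
      exact this.mono_left nhdsWithin_le_nhds
    refine squeeze_zero_norm' ?_ hlim
    filter_upwards [self_mem_nhdsWithin] with z hz
    exact (R.norm_param_arg z (hmax' z hz)).le

lemma continuous_param :
    Continuous fun x : (orderComplex Q).Realization => R.param x.coords :=
  continuous_of_continuousOn_closedSimplex R.continuousOn_param_closedSimplex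

end RegularCells

namespace RegularCells

open Metric Set PreAbstractSimplicialComplex PreAbstractSimplicialComplex.Realization

variable {Q : Type u} [PartialOrder Q] {X : Type u} [TopologicalSpace X] (R : RegularCells Q X)

/-- The subdivided boundary of a cell is a sphere. -/
theorem nonempty_homeomorph_sphere [T2Space X] (q : Q) :
    Nonempty ({x : (orderComplex Q).Realization | ∀ z ∈ x.coords.support, z < q} ≃ₜ
      sphere (0 : Fin (R.dim q) → ℝ) 1) := by
  have : Nonempty X := ⟨R.char q 0⟩
  let A := {x : (orderComplex Q).Realization | ∀ z ∈ x.coords.support, z < q}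
  have hA : IsCompact A := by
    convert isCompact_support_subset (K := orderComplex Q) (R.finite_Iio q).toFinset using 1
    ext x
    simp [A, Finset.subset_iff]
  have : CompactSpace A := isCompact_iff_compactSpace.1 hA
  let F : A → sphere (0 : Fin (R.dim q) → ℝ) 1 := fun x =>
    ⟨R.inv q (R.param x.1.coords), R.inv_mem_sphere (R.param_mem_sphere x.1 x.2)⟩
  have hF : Continuous F := Continuous.subtype_mk ((R.continuousOn_inv q).comp_continuous
    (R.continuous_param.comp continuous_subtype_val) fun x =>
      image_mono sphere_subset_closedBall (R.param_mem_sphere x.1 x.2)) _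
  have hbij : Function.Bijective F := by
    constructor
    · intro x y hxy
      have h : R.inv q (R.param x.1.coords) = R.inv q (R.param y.1.coords) :=
        congrArg Subtype.val hxy
      refine Subtype.ext (R.param_injective ?_)
      change R.param x.1.coords = R.param y.1.coords
      rw [← R.char_inv (image_mono sphere_subset_closedBall (R.param_mem_sphere x.1 x.2)),
        ← R.char_inv (image_mono sphere_subset_closedBall (R.param_mem_sphere y.1 y.2)), h]
    · rintro ⟨y, hy⟩
      have hp := mem_image_of_mem (R.char q) hy
      rw [R.image_sphere] at hp
      simp only [mem_iUnion] at hp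
      obtain ⟨r, hr, hp⟩ := hp
      obtain ⟨x, hx, hxp⟩ := R.exists_param_eq r _ (image_mono ball_subset_closedBall hp)
      refine ⟨⟨x, fun z hz => (hx z hz).trans_lt hr⟩, Subtype.ext ?_⟩
      change R.inv q (R.param x.coords) = y
      rw [hxp, R.inv_char (sphere_subset_closedBall hy)]
  exact ⟨Continuous.homeoOfEquivCompactToT2 (f := Equiv.ofBijective F hbij) hF⟩

lemma dim_lt_dim [T2Space X] {r q : Q} (h : r < q) : R.dim r < R.dim q := by
  classical
  have hmem : ∀ y ∈ ball (0 : Fin (R.dim r) → ℝ) 1, R.char r y ∈ R.char q '' sphere 0 1 :=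
    fun y hy => R.image_ball_subset_sphere h (mem_image_of_mem _ hy)
  have h0 := R.inv_mem_sphere (hmem 0 (by simp))
  let f : (Fin (R.dim r) → ℝ) → sphere (0 : Fin (R.dim q) → ℝ) 1 := fun y =>
    if hy : y ∈ ball (0 : Fin (R.dim r) → ℝ) 1 then
      ⟨R.inv q (R.char r y), R.inv_mem_sphere (hmem y hy)⟩ else ⟨_, h0⟩
  have hf : ∀ y ∈ ball (0 : Fin (R.dim r) → ℝ) 1, (f y : Fin (R.dim q) → ℝ) =
      R.inv q (R.char r y) := fun y hy => by simp only [f, dif_pos hy]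
  refine lt_of_continuousOn_injOn_sphere (U := ball 0 1) isOpen_ball ⟨0, by simp⟩ (h := f) ?_ ?_
  · rw [continuousOn_iff_continuous_domRestrict, continuous_induced_rng]
    have : ContinuousOn (fun y => R.inv q (R.char r y)) (ball (0 : Fin (R.dim r) → ℝ) 1) :=
      (R.continuousOn_inv q).comp ((R.continuousOn_char r).mono ball_subset_closedBall)
        fun y hy => image_mono sphere_subset_closedBall (hmem y hy)
    refine (continuousOn_iff_continuous_domRestrict.1 this).congr fun y => (hf y y.2).symm
  · intro y hy z hz hyz
    have hyz' := congrArg Subtype.val hyz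
    rw [hf y hy, hf z hz] at hyz'
    refine R.injOn_char r (ball_subset_closedBall hy) (ball_subset_closedBall hz) ?_
    rw [← R.char_inv (image_mono sphere_subset_closedBall (hmem y hy)),
      ← R.char_inv (image_mono sphere_subset_closedBall (hmem z hz)), hyz']

lemma image_closedBall (q : Q) : R.char q '' closedBall 0 1 = ⋃ r ≤ q, R.char r '' ball 0 1 := by
  rw [← sphere_union_ball, image_union, R.image_sphere]
  ext x
  simp only [mem_union, mem_iUnion, le_iff_lt_or_eq, exists_prop]
  constructor
  · rintro (⟨r, hr, hx⟩ | hx)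
    · exact ⟨r, Or.inl hr, hx⟩
    · exact ⟨q, Or.inr rfl, hx⟩
  · rintro ⟨r, hr | rfl, hx⟩
    · exact Or.inl ⟨r, hr, hx⟩
    · exact Or.inr hx

lemma image_closedBall_subset_iff {q r : Q} :
    R.char q '' closedBall 0 1 ⊆ R.char r '' closedBall 0 1 ↔ q ≤ r := by
  constructor
  · intro h
    have hq : R.char q 0 ∈ R.char q '' ball 0 1 := mem_image_of_mem _ (by simp)
    have := h (image_mono ball_subset_closedBall hq)
    rw [R.image_closedBall] at this
    simp only [mem_iUnion] at this
    obtain ⟨s, hs, hqs⟩ := this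
    by_cases hne : q = s
    · rwa [hne]
    · exact absurd hqs (disjoint_left.1 (R.disjoint q s hne) hq)
  · intro h
    rw [R.image_closedBall, R.image_closedBall]
    exact biUnion_subset_biUnion_left fun s (hs : s ≤ q) => hs.trans h

/-- A regular cell decomposition that covers the space and determines its topology is a CW complex
structure. -/
@[reducible]
noncomputable def cwComplex [T2Space X]
    (hcover : ∀ x, ∃ q, x ∈ R.char q '' ball 0 1)
    (hclosed : ∀ A : Set X, (∀ q, IsClosed (A ∩ R.char q '' closedBall 0 1)) → IsClosed A) :
    Topology.CWComplex (univ : Set X) where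
  cell n := {q : Q // R.dim q = n}
  map n i := i.2 ▸ BijOn.toPartialEquiv (R.char i.1) (ball 0 1) (R.char i.1 '' ball 0 1)
    (((R.injOn_char i.1).mono ball_subset_closedBall).bijOn_image)
  source_eq := by
    rintro _ ⟨q, rfl⟩
    rfl
  continuousOn := by
    rintro _ ⟨q, rfl⟩
    exact R.continuousOn_char q
  continuousOn_symm := by
    rintro _ ⟨q, rfl⟩
    refine ((R.continuousOn_inv q).mono (image_mono ball_subset_closedBall)).congr ?_
    rintro _ ⟨y, hy, rfl⟩
    rw [R.inv_char (ball_subset_closedBall hy)]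
    exact ((R.injOn_char q).mono ball_subset_closedBall).leftInvOn_invFunOn hy
  pairwiseDisjoint' := by
    rintro ⟨_, q, rfl⟩ - ⟨_, r, rfl⟩ - hne
    refine R.disjoint q r ?_
    rintro rfl
    exact hne rfl
  mapsTo' := by
    rintro _ ⟨q, rfl⟩
    refine ⟨fun m => ((R.finite_Iio q).preimage Subtype.val_injective.injOn).toFinset, ?_⟩
    intro y hy
    have hp := mem_image_of_mem (R.char q) hy
    rw [R.image_sphere] at hp
    simp only [mem_iUnion] at hp ⊢
    obtain ⟨r, hr, hp⟩ := hp
    exact ⟨R.dim r, R.dim_lt_dim hr, ⟨r, rfl⟩, by simpa using hr,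
      image_mono ball_subset_closedBall hp⟩
  closed' A _ h := hclosed A fun q => h _ ⟨q, rfl⟩
  union' := by
    refine eq_univ_of_forall fun x => ?_
    obtain ⟨q, hq⟩ := hcover x
    simp only [mem_iUnion]
    exact ⟨R.dim q, ⟨q, rfl⟩, image_mono ball_subset_closedBall hq⟩

theorem isCellPoset [T2Space X] (hcover : ∀ x, ∃ q, x ∈ R.char q '' ball 0 1)
    (hclosed : ∀ A : Set X, (∀ q, IsClosed (A ∩ R.char q '' closedBall 0 1)) → IsClosed A) :
    IsCellPoset Q := by
  let C := R.cwComplex hcover hclosed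
  refine ⟨X, inferInstance, inferInstance, C, ?_, ?_⟩
  · rintro _ ⟨q, rfl⟩
    have : CompactSpace (closedBall (0 : Fin (R.dim q) → ℝ) 1) :=
      isCompact_iff_compactSpace.1 (isCompact_closedBall _ _)
    exact ((continuousOn_iff_continuous_domRestrict.1
      (R.continuousOn_char q)).isClosedEmbedding (injOn_iff_injective.1
        (R.injOn_char q))).isEmbedding
  · let F : Q ↪o cwCells X := OrderEmbedding.ofMapLEIff
      (fun q => ⟨R.char q '' closedBall 0 1, R.dim q, ⟨q, rfl⟩, rfl⟩)
      fun q r => R.image_closedBall_subset_iff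
    refine ⟨RelIso.ofSurjective F ?_⟩
    rintro ⟨_, _, ⟨q, rfl⟩, rfl⟩
    exact ⟨q, rfl⟩

end RegularCells

/-! ### Cell posets and spheres -/

section CellPoset

open Metric Set Topology Topology.RelCWComplex PreAbstractSimplicialComplex
  PreAbstractSimplicialComplex.Realization

lemma closedCell_injective {X : Type u} [TopologicalSpace X] [CWComplex (univ : Set X)]
    {c d : Σ m, cell (univ : Set X) m} (h : closedCell c.1 c.2 = closedCell d.1 d.2) : c = d := by
  by_contra hne
  rcases le_total c.1 d.1 with hle | hle
  · have := disjoint_openCell_closedCell (Ne.symm hne) hle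
    rw [h] at this
    exact disjoint_left.1 this (map_zero_mem_openCell _ _) (map_zero_mem_closedCell _ _)
  · have := disjoint_openCell_closedCell hne hle
    rw [← h] at this
    exact disjoint_left.1 this (map_zero_mem_openCell _ _) (map_zero_mem_closedCell _ _)

/-- The cells of a regular CW complex form a regular cell decomposition: by invariance of domain,
boundaries of cells are unions of cells. -/
lemma IsCellPoset.exists_regularCells {P : Type u} [PartialOrder P] (hP : IsCellPoset P) :
    ∃ (X : Type u) (_ : TopologicalSpace X) (_ : T2Space X), Nonempty (RegularCells P X) := by
  obtain ⟨X, _, _, _, hX, ⟨E⟩⟩ := hP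
  refine ⟨X, inferInstance, inferInstance, ?_⟩
  have hc : ∀ p : P, ∃ c : Σ m, cell (univ : Set X) m, (E p : Set X) = closedCell c.1 c.2 :=
    fun p => let ⟨n, i, h⟩ := (E p).2; ⟨⟨n, i⟩, h⟩
  choose c hc using hc
  have hle : ∀ {p q : P}, p ≤ q ↔ closedCell (c p).1 (c p).2 ⊆ closedCell (c q).1 (c q).2 := by
    intro p q
    rw [← hc, ← hc, ← E.le_iff_le]
    rfl
  have hinj : Function.Injective c := fun p q h =>
    le_antisymm (hle.2 (by rw [h])) (hle.2 (by rw [h]))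
  have hsurj : Function.Surjective c := by
    intro d
    refine ⟨E.symm ⟨closedCell d.1 d.2, d.1, d.2, rfl⟩, closedCell_injective ?_⟩
    rw [← hc, OrderIso.apply_symm_apply]
  have hfr : ∀ {p q : P}, p < q → openCell (c p).1 (c p).2 ⊆ cellFrontier (c q).1 (c q).2 := by
    intro p q hpq x hx
    have h1 := hle.1 hpq.le (openCell_subset_closedCell _ _ hx)
    rw [← cellFrontier_union_openCell_eq_closedCell] at h1
    refine h1.resolve_right fun h2 => ?_
    exact disjoint_left.1 (disjoint_openCell_of_ne fun h => hpq.ne (hinj h)) hx h2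
  refine ⟨⟨fun p => (c p).1, fun p => map (c p).1 (c p).2, fun p => continuousOn _ _,
    fun p => hX.injOn_map _ _, fun p q hpq => disjoint_openCell_of_ne fun h => hpq (hinj h),
    fun q => ?_, fun q => ?_⟩⟩
  · apply Subset.antisymm
    · intro x hx
      obtain ⟨I, hI, hsub⟩ := exists_finset_cellFrontier_subset (c q).1 (c q).2
      obtain ⟨d, hd, hxd⟩ := hsub x hx
      obtain ⟨r, rfl⟩ := hsurj d
      have h1 := openCell_subset_cellFrontier hX _ (c q).2 (c r) (not_disjoint_iff.2 ⟨x, hxd, hx⟩)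
      have h2 : closedCell (c r).1 (c r).2 ⊆ closedCell (c q).1 (c q).2 := by
        rw [← closure_openCell_eq_closedCell]
        exact closure_minimal (h1.trans (cellFrontier_subset_closedCell _ _)) isClosed_closedCell
      have hrq : r < q := lt_of_le_of_ne (hle.2 h2) fun h => by
        have := hI _ hd
        rw [h] at this
        exact lt_irrefl _ this
      exact mem_biUnion (show r ∈ {r | r < q} from hrq) hxd
    · exact iUnion₂_subset fun r hr => hfr hr
  · obtain ⟨I, hI, hsub⟩ := exists_finset_cellFrontier_subset (c q).1 (c q).2
    refine Finite.of_finite_image (f := c) (I.finite_toSet.subset ?_) hinj.injOn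
    rintro _ ⟨p, hp, rfl⟩
    have h0 := map_zero_mem_openCell (c p).1 (c p).2
    obtain ⟨d, hd, hxd⟩ := hsub _ (hfr hp h0)
    have : c p = d := eq_of_not_disjoint_openCell (not_disjoint_iff.2 ⟨_, h0, hxd⟩)
    rwa [this]

lemma isChain_map_iff {V W : Type*} [PartialOrder V] [PartialOrder W] (e : W ↪o V) (τ : Finset W) :
    IsChain (· ≤ ·) (τ.map e.toEmbedding : Set V) ↔ IsChain (· ≤ ·) (τ : Set W) := by
  rw [Finset.coe_map]
  constructor
  · intro h a ha b hb hab
    have := h (mem_image_of_mem _ ha) (mem_image_of_mem _ hb) fun h => hab (e.injective h)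
    simpa using this
  · rintro h _ ⟨a, ha, rfl⟩ _ ⟨b, hb, rfl⟩ hab
    have := h ha hb fun h => hab (h ▸ rfl)
    simpa using this

lemma mem_faces_orderComplex_subtype {P : Type u} [PartialOrder P] (S : Set P) (τ : Finset S) :
    τ ∈ (orderComplex S).faces ↔ τ.map (Function.Embedding.subtype _) ∈ (orderComplex P).faces :=
  and_congr (by simp) (isChain_map_iff (OrderEmbedding.subtype (· ∈ S)) τ).symm

/-- The order complex of a finite subset of a poset as a subcomplex of the order complex. -/
lemma nonempty_homeomorph_orderComplex_subset {P : Type u} [PartialOrder P] {S : Set P}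
    (hS : S.Finite) : Nonempty ((orderComplex S).Realization ≃ₜ
      {x : (orderComplex P).Realization | ∀ z ∈ x.coords.support, z ∈ S}) := by
  have : Finite S := hS
  obtain ⟨h⟩ := nonempty_homeomorph_support_subset (orderComplex P) (orderComplex S)
    (Function.Embedding.subtype (· ∈ S)) (mem_faces_orderComplex_subtype S)
  refine ⟨h.trans (Homeomorph.setCongr ?_)⟩
  ext x
  simp [Set.subset_def]

lemma isHomeomorphicToSphere_of_homeomorph {X : Type u} [TopologicalSpace X] {n : ℕ}
    (h : X ≃ₜ sphere (0 : Fin n → ℝ) 1) : IsHomeomorphicToSphere X :=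
  ⟨n, ⟨h.trans (supSphereHomeomorph n)⟩⟩

theorem IsCellPoset.finite_Iio {P : Type u} [PartialOrder P] (hP : IsCellPoset P) (x : P) :
    (Iio x).Finite := by
  obtain ⟨X, _, _, ⟨R⟩⟩ := hP.exists_regularCells
  exact R.finite_Iio x

/-- The under set of a cell subdivides the boundary of the cell, a sphere. -/
theorem IsCellPoset.isHomeomorphicToSphere_Iio {P : Type u} [PartialOrder P] (hP : IsCellPoset P)
    (x : P) : IsHomeomorphicToSphere (orderComplex (Iio x)).Realization := by
  obtain ⟨X, _, _, ⟨R⟩⟩ := hP.exists_regularCells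
  obtain ⟨h⟩ := nonempty_homeomorph_orderComplex_subset (R.finite_Iio x)
  obtain ⟨h'⟩ := R.nonempty_homeomorph_sphere x
  exact isHomeomorphicToSphere_of_homeomorph (h.trans h')

end CellPoset

section CellPosetOfSpheres

open Metric Set PreAbstractSimplicialComplex PreAbstractSimplicialComplex.Realization

lemma PreAbstractSimplicialComplex.Realization.isClosed_of_inter_closedSimplex {V : Type u}
    {K : PreAbstractSimplicialComplex V} {A : Set K.Realization}
    (h : ∀ s ∈ K.faces, IsClosed (A ∩ closedSimplex K s)) : IsClosed A := by
  refine isClosed_iSup_iff.2 fun s => isClosed_coinduced.2 ?_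
  let _ := simplexTopology K s.1
  have := (h s.1 s.2).preimage (continuous_coe_of_simplexTopology s.2)
  simpa using this

variable {Q : Type u} [PartialOrder Q]

/-- A homeomorphism from the order complex of `S` to a sphere extends radially to a bijection from
the ambient vector space to the nonnegative vectors supported on chains of `S`. -/
lemma exists_radial_extension {S : Set Q} {E : Type*} [NormedAddCommGroup E] [NormedSpace ℝ E]
    (φ : {x : (orderComplex Q).Realization | ∀ z ∈ x.coords.support, z ∈ S} ≃ₜ
      sphere (0 : E) 1) :
    ∃ α : E → Q →₀ ℝ, (∀ v, Continuous fun y => α y v) ∧ (∀ y v, 0 ≤ α y v) ∧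
      (∀ y, ∀ z ∈ (α y).support, z ∈ S) ∧
      (∀ y, IsChain (· ≤ ·) ((α y).support : Set Q)) ∧
      (∀ y, ((α y).sum fun _ r => r) = ‖y‖) ∧ Function.Injective α ∧
      ∀ f : Q →₀ ℝ, (∀ v, 0 ≤ f v) → (∀ z ∈ f.support, z ∈ S) →
        IsChain (· ≤ ·) (f.support : Set Q) → ∃ y, α y = f := by
  classical
  have hu : ∀ y : E, y ≠ 0 → ‖y‖⁻¹ • y ∈ sphere (0 : E) 1 := fun y hy => by
    rw [mem_sphere_zero_iff_norm, norm_smul, norm_inv, norm_norm,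
      inv_mul_cancel₀ (norm_ne_zero_iff.2 hy)]
  let g : ∀ y : E, y ≠ 0 → (orderComplex Q).Realization := fun y hy =>
    (φ.symm ⟨_, hu y hy⟩).1
  have hg : ∀ y hy, ∀ z ∈ (g y hy).coords.support, z ∈ S := fun y hy =>
    (φ.symm ⟨_, hu y hy⟩).2
  let α : E → Q →₀ ℝ := fun y => if hy : y ≠ 0 then ‖y‖ • (g y hy).coords else 0
  have hα : ∀ y (hy : y ≠ 0), α y = ‖y‖ • (g y hy).coords := fun y hy => dif_pos hy
  have hα0 : α 0 = 0 := dif_neg fun h => h rfl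
  have hsupp : ∀ y (hy : y ≠ 0), (α y).support = (g y hy).coords.support := fun y hy => by
    rw [hα y hy, Finsupp.support_smul_eq (norm_ne_zero_iff.2 hy)]
  have hsum : ∀ y, ((α y).sum fun _ r => r) = ‖y‖ := fun y => by
    rcases eq_or_ne y 0 with rfl | hy
    · simp [hα0]
    · rw [hα y hy, sum_smul_coords, sum_coords, mul_one]
  refine ⟨α, fun v => ?_, fun y v => ?_, fun y => ?_, fun y => ?_, hsum, fun y z hyz => ?_,
    fun f h0 hS hch => ?_⟩
  · rw [continuous_iff_continuousAt]
    intro y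
    rcases eq_or_ne y 0 with rfl | hy0
    · rw [ContinuousAt, hα0]
      refine squeeze_zero_norm (a := fun y => ‖y‖) (fun z => ?_) tendsto_norm_zero
      rcases eq_or_ne z 0 with rfl | hz
      · simp [hα0]
      · rw [hα z hz, Finsupp.smul_apply, norm_smul, norm_norm,
          Real.norm_of_nonneg ((g z hz).coords_nonneg v)]
        exact mul_le_of_le_one_right (norm_nonneg _) ((g z hz).coords_le_one v)
    · have hA : ContinuousOn (fun y => α y v) {0}ᶜ := by
        rw [continuousOn_iff_continuous_domRestrict]
        have : Continuous fun y : ({0}ᶜ : Set E) => ‖(y : E)‖ * (g y y.2).coords v := by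
          refine (continuous_norm.comp continuous_subtype_val).mul
            ((continuous_coords_apply v).comp (continuous_subtype_val.comp
            (φ.symm.continuous.comp (Continuous.subtype_mk (Continuous.smul
              (Continuous.inv₀ (continuous_norm.comp continuous_subtype_val) fun y =>
                norm_ne_zero_iff.2 y.2) continuous_subtype_val) _))))
        exact this.congr fun y => by rw [domRestrict_apply, hα y y.2, Finsupp.smul_apply,
          smul_eq_mul]
      exact hA.continuousAt (isOpen_compl_singleton.mem_nhds hy0)
  · rcases eq_or_ne y 0 with rfl | hy
    · simp [hα0]
    · rw [hα y hy]
      exact mul_nonneg (norm_nonneg _) ((g y hy).coords_nonneg v)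
  · rcases eq_or_ne y 0 with rfl | hy
    · simp [hα0]
    · rw [hsupp y hy]
      exact hg y hy
  · rcases eq_or_ne y 0 with rfl | hy
    · simp [hα0]
    · rw [hsupp y hy]
      exact (g y hy).support_coords_mem.2
  · have hn : ‖y‖ = ‖z‖ := by rw [← hsum, ← hsum, hyz]
    rcases eq_or_ne y 0 with rfl | hy
    · rw [norm_zero] at hn
      exact (norm_eq_zero.1 hn.symm).symm
    · have hpos := norm_pos_iff.2 hy
      have hz : z ≠ 0 := norm_pos_iff.1 (hn ▸ hpos)
      rw [hα y hy, hα z hz, ← hn] at hyz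
      have hgg := congrArg Subtype.val (φ.symm.injective (Subtype.ext
        (coords_injective (smul_right_injective _ hpos.ne' hyz))))
      simp only [← hn] at hgg
      exact smul_right_injective _ (inv_ne_zero hpos.ne') hgg
  · rcases eq_or_ne f 0 with rfl | hf
    · exact ⟨0, hα0⟩
    · have hm : 0 < f.sum fun _ r => r := Finset.sum_pos
        (fun v hv => lt_of_le_of_ne (h0 v) (Finsupp.mem_support_iff.1 hv).symm)
        (Finsupp.support_nonempty_iff.2 hf)
      set m := f.sum fun _ r => r with hmdef
      have hs : (m⁻¹ • f).support = f.support := Finsupp.support_smul_eq (inv_ne_zero hm.ne')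
      let x : (orderComplex Q).Realization := ofFinsupp (m⁻¹ • f)
        (fun v => mul_nonneg (inv_nonneg.2 hm.le) (h0 v))
        (by rw [hs]; exact ⟨Finsupp.support_nonempty_iff.2 hf, hch⟩)
        (by rw [sum_smul_coords, ← hmdef, inv_mul_cancel₀ hm.ne'])
      have hx : x ∈ {x : (orderComplex Q).Realization | ∀ z ∈ x.coords.support, z ∈ S} := by
        intro z hz
        have hz' : z ∈ (m⁻¹ • f).support := hz
        rw [hs] at hz'
        exact hS z hz'
      set u := φ ⟨x, hx⟩ with hu_def
      have hn : ‖m • (u : E)‖ = m := by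
        rw [norm_smul, mem_sphere_zero_iff_norm.1 u.2, mul_one, Real.norm_of_nonneg hm.le]
      have hne : m • (u : E) ≠ 0 := by
        rw [← norm_ne_zero_iff, hn]
        exact hm.ne'
      have hgx : g _ hne = x := by
        have : (⟨_, hu _ hne⟩ : sphere (0 : E) 1) = u := Subtype.ext (by
          change ‖m • (u : E)‖⁻¹ • m • (u : E) = u
          rw [hn, smul_smul, inv_mul_cancel₀ hm.ne', one_smul])
        simp only [g]
        rw [this, hu_def, φ.symm_apply_apply]
      refine ⟨m • (u : E), ?_⟩
      rw [hα _ hne, hgx, hn, show x.coords = m⁻¹ • f from rfl, smul_smul, mul_inv_cancel₀ hm.ne',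
        one_smul]

/-- If the order complex of the elements below `q` is a sphere, then coning off gives a
characteristic map for the order complex of the elements up to `q`. -/
lemma exists_char_of_homeomorph_sphere {q : Q} (hfin : (Iio q).Finite) {n : ℕ}
    (h : {x : (orderComplex Q).Realization | ∀ z ∈ x.coords.support, z < q} ≃ₜ
      sphere (0 : Fin n → ℝ) 1) :
    ∃ c : (Fin n → ℝ) → (orderComplex Q).Realization, ContinuousOn c (closedBall 0 1) ∧
      InjOn c (closedBall 0 1) ∧
      c '' ball 0 1 = {x | q ∈ x.coords.support ∧ ∀ z ∈ x.coords.support, z ≤ q} ∧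
      c '' sphere 0 1 = {x | ∀ z ∈ x.coords.support, z < q} := by
  classical
  obtain ⟨α, hαc, hα0, hαS, hαch, hαsum, hαinj, hαsurj⟩ := exists_radial_extension (S := Iio q) h
  have hαlt : ∀ y, ∀ z ∈ (α y).support, z < q := hαS
  let c : (Fin n → ℝ) → (orderComplex Q).Realization := fun y =>
    if hy : ‖y‖ ≤ 1 then cone q (α y) (hα0 y) (hαlt y) (hαch y) ((hαsum y).trans_le hy)
    else vertex q
  have hc : ∀ y (hy : ‖y‖ ≤ 1),
      c y = cone q (α y) (hα0 y) (hαlt y) (hαch y) ((hαsum y).trans_le hy) :=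
    fun y hy => dif_pos hy
  have hle : ∀ y, ‖y‖ ≤ 1 → ∀ z ∈ (c y).coords.support, z ≤ q := fun y hy z hz => by
    rw [hc y hy] at hz
    exact le_of_mem_support_cone hz
  have hcq : ∀ y, ‖y‖ ≤ 1 → (c y).coords q = 1 - ‖y‖ := fun y hy => by
    rw [hc y hy, coords_cone_apex, hαsum]
  have hcv : ∀ y, ‖y‖ ≤ 1 → ∀ v, v ≠ q → (c y).coords v = α y v := fun y hy v hv => by
    rw [hc y hy, coords_cone_of_ne hv]
  have hce : ∀ y, ‖y‖ ≤ 1 → (c y).coords.erase q = α y := fun y hy => by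
    rw [hc y hy, erase_coords_cone]
  have hsurj : ∀ x : (orderComplex Q).Realization, (∀ z ∈ x.coords.support, z ≤ q) →
      ∃ y, ‖y‖ = 1 - x.coords q ∧ c y = x := by
    intro x hx
    have hsup : (x.coords.erase q).support ⊆ x.coords.support := by
      rw [Finsupp.support_erase]; exact Finset.erase_subset _ _
    obtain ⟨y, hy⟩ := hαsurj (x.coords.erase q)
      (fun v => by
        rw [Finsupp.erase_apply]
        split_ifs
        · exact le_rfl
        · exact x.coords_nonneg v)
      (fun z hz => by
        refine lt_of_le_of_ne (hx z (hsup hz)) ?_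
        rintro rfl
        simp at hz)
      (x.support_coords_mem.2.mono (Finset.coe_subset.2 hsup))
    have hn : ‖y‖ = 1 - x.coords q := by rw [← hαsum, hy, sum_erase_coords]
    have hn1 : ‖y‖ ≤ 1 := by rw [hn]; linarith [x.coords_nonneg q]
    refine ⟨y, hn, coords_injective ?_⟩
    rw [← Finsupp.single_add_erase q (c y).coords, hce y hn1, hcq y hn1, hn, hy, sub_sub_cancel,
      Finsupp.single_add_erase]
  refine ⟨c, ?_, ?_, ?_, ?_⟩
  · rw [continuousOn_iff_continuous_domRestrict]
    refine continuous_of_continuous_coords (insert q hfin.toFinset) ?_ ?_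
    · intro y z hz
      rcases (hle _ (mem_closedBall_zero_iff.1 y.2) z hz).eq_or_lt with h | h
      · exact Finset.mem_insert.2 (Or.inl h)
      · exact Finset.mem_insert_of_mem (by simpa using h)
    · intro v _
      suffices hcont : ContinuousOn (fun y => (c y).coords v) (closedBall 0 1) from
        continuousOn_iff_continuous_domRestrict.1 hcont
      by_cases hv : v = q
      · rw [hv]
        exact (continuousOn_const.sub continuous_norm.continuousOn).congr fun y hy =>
          hcq y (mem_closedBall_zero_iff.1 hy)
      · exact (hαc v).continuousOn.congr fun y hy => hcv y (mem_closedBall_zero_iff.1 hy) v hv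
  · intro y hy z hz hyz
    rw [mem_closedBall_zero_iff] at hy hz
    exact hαinj (by rw [← hce y hy, ← hce z hz, hyz])
  · ext x
    constructor
    · rintro ⟨y, hy, rfl⟩
      have hy1 := mem_ball_zero_iff.1 hy
      refine ⟨Finsupp.mem_support_iff.2 ?_, hle y hy1.le⟩
      rw [hcq y hy1.le]
      linarith
    · rintro ⟨hq, hx⟩
      obtain ⟨y, hy, rfl⟩ := hsurj x hx
      have h1 := (c y).coords_nonneg q
      have h2 : (c y).coords q ≠ 0 := Finsupp.mem_support_iff.1 hq
      refine ⟨y, ?_, rfl⟩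
      rw [mem_ball_zero_iff, hy]
      have := lt_of_le_of_ne h1 h2.symm
      linarith
  · ext x
    constructor
    · rintro ⟨y, hy, rfl⟩ z hz
      have hy1 := mem_sphere_zero_iff_norm.1 hy
      refine lt_of_le_of_ne (hle y hy1.le z hz) ?_
      rintro rfl
      refine Finsupp.mem_support_iff.1 hz ?_
      rw [hcq y hy1.le, hy1, sub_self]
    · intro hx
      obtain ⟨y, hy, rfl⟩ := hsurj x fun z hz => (hx z hz).le
      refine ⟨y, ?_, rfl⟩
      rw [mem_sphere_zero_iff_norm, hy, apex_eq_zero hx, sub_zero]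

/-- A poset in which the order complexes of all under sets are spheres is a cell poset: the
realization of its order complex is a regular CW complex whose closed cells are the subcomplexes
of elements up to `q`. -/
theorem isCellPoset_of_isHomeomorphicToSphere_Iio (hfin : ∀ q : Q, (Iio q).Finite)
    (hS : ∀ q : Q, IsHomeomorphicToSphere (orderComplex (Iio q)).Realization) :
    IsCellPoset Q := by
  have hchar : ∀ q : Q, ∃ n : ℕ, ∃ c : (Fin n → ℝ) → (orderComplex Q).Realization,
      ContinuousOn c (closedBall 0 1) ∧ InjOn c (closedBall 0 1) ∧
      c '' ball 0 1 = {x | q ∈ x.coords.support ∧ ∀ z ∈ x.coords.support, z ≤ q} ∧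
      c '' sphere 0 1 = {x | ∀ z ∈ x.coords.support, z < q} := by
    intro q
    obtain ⟨n, ⟨e⟩⟩ := hS q
    obtain ⟨e'⟩ := nonempty_homeomorph_orderComplex_subset (hfin q)
    exact ⟨n, exists_char_of_homeomorph_sphere (hfin q)
      ((e'.symm.trans e).trans (supSphereHomeomorph n).symm)⟩
  choose dim char hcont hinj hball hsphere using hchar
  let R : RegularCells Q (orderComplex Q).Realization :=
    { dim := dim
      char := char
      continuousOn_char := hcont
      injOn_char := hinj
      disjoint := fun q r hne => by
        rw [hball, hball, disjoint_left]
        exact fun x hq hr => hne (le_antisymm (hr.2 q hq.1) (hq.2 r hr.1))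
      image_sphere := fun q => by
        rw [hsphere]
        ext x
        simp only [hball, mem_iUnion, mem_ofPred_eq, exists_prop]
        constructor
        · intro hx
          obtain ⟨r, hr, hmax⟩ := exists_greatest_of_mem_faces x.support_coords_mem
          exact ⟨r, hx r hr, hr, hmax⟩
        · rintro ⟨r, hrq, -, hmax⟩ z hz
          exact (hmax z hz).trans_lt hrq
      finite_Iio := hfin }
  refine R.isCellPoset (fun x => ?_) fun A hA => ?_
  · obtain ⟨r, hr, hmax⟩ := exists_greatest_of_mem_faces x.support_coords_mem
    exact ⟨r, (hball r).symm ▸ ⟨hr, hmax⟩⟩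
  · refine isClosed_of_inter_closedSimplex fun s hs => ?_
    obtain ⟨r, hr, hmax⟩ := exists_greatest_of_mem_faces hs
    have hsub : closedSimplex (orderComplex Q) s ⊆ char r '' closedBall 0 1 := by
      intro x hx
      rw [← sphere_union_ball, image_union, hball, hsphere]
      have hxr : ∀ z ∈ x.coords.support, z ≤ r := fun z hz => hmax z (hx hz)
      by_cases h : r ∈ x.coords.support
      · exact Or.inr ⟨h, hxr⟩
      · exact Or.inl fun z hz => lt_of_le_of_ne (hxr z hz) fun hzr => h (hzr ▸ hz)
    have : A ∩ closedSimplex (orderComplex Q) s =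
        (A ∩ char r '' closedBall 0 1) ∩ closedSimplex (orderComplex Q) s := by
      rw [inter_assoc, inter_eq_self_of_subset_right hsub]
    rw [this]
    exact (hA r).inter (isCompact_closedSimplex hs).isClosed

end CellPosetOfSpheres

/-! ### Joins and links -/

section Join

open Metric Set PreAbstractSimplicialComplex PreAbstractSimplicialComplex.Realization

lemma IsHomeomorphicToSphere.of_homeomorph {X Y : Type u} [TopologicalSpace X]
    [TopologicalSpace Y] (hY : IsHomeomorphicToSphere Y) (h : X ≃ₜ Y) :
    IsHomeomorphicToSphere X := by
  obtain ⟨n, ⟨e⟩⟩ := hY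
  exact ⟨n, ⟨h.trans e⟩⟩

/-- The join of two "radial" parametrizations of order complexes `A` and `B`, one lying above the
other, is a parametrization of the order complex of `A ∪ B` by the unit sphere of the `ℓ¹`-sum. -/
lemma nonempty_homeomorph_join {P : Type u} [PartialOrder P] {A B : Set P}
    (hA : A.Finite) (hB : B.Finite) (hAB : ∀ a ∈ A, ∀ b ∈ B, a < b)
    {E F : Type} [NormedAddCommGroup E] [NormedSpace ℝ E] [FiniteDimensional ℝ E]
    [NormedAddCommGroup F] [NormedSpace ℝ F] [FiniteDimensional ℝ F]
    {α : E → P →₀ ℝ} (hαc : ∀ v, Continuous fun y => α y v) (hα0 : ∀ y v, 0 ≤ α y v)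
    (hαA : ∀ y, ∀ v ∈ (α y).support, v ∈ A)
    (hαch : ∀ y, IsChain (· ≤ ·) ((α y).support : Set P))
    (hαsum : ∀ y, ((α y).sum fun _ r => r) = ‖y‖) (hαinj : Function.Injective α)
    (hαsurj : ∀ f : P →₀ ℝ, (∀ v, 0 ≤ f v) → (∀ v ∈ f.support, v ∈ A) →
      IsChain (· ≤ ·) (f.support : Set P) → ∃ y, α y = f)
    {β : F → P →₀ ℝ} (hβc : ∀ v, Continuous fun y => β y v) (hβ0 : ∀ y v, 0 ≤ β y v)
    (hβB : ∀ y, ∀ v ∈ (β y).support, v ∈ B)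
    (hβch : ∀ y, IsChain (· ≤ ·) ((β y).support : Set P))
    (hβsum : ∀ y, ((β y).sum fun _ r => r) = ‖y‖) (hβinj : Function.Injective β)
    (hβsurj : ∀ f : P →₀ ℝ, (∀ v, 0 ≤ f v) → (∀ v ∈ f.support, v ∈ B) →
      IsChain (· ≤ ·) (f.support : Set P) → ∃ y, β y = f) :
    Nonempty (sphere (0 : WithLp 1 (E × F)) 1 ≃ₜ
      {x : (orderComplex P).Realization | ∀ z ∈ x.coords.support, z ∈ A ∪ B}) := by
  classical
  have hnorm : ∀ w : WithLp 1 (E × F), ‖w‖ = ‖w.fst‖ + ‖w.snd‖ := fun w => by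
    rw [WithLp.prod_norm_eq_add (by simp)]
    simp
  have hdisj : ∀ z, z ∈ A → z ∉ B := fun z hzA hzB => lt_irrefl z (hAB z hzA z hzB)
  have hαv : ∀ y, ∀ v ∉ A, α y v = 0 := fun y v hv => by
    by_contra h; exact hv (hαA y v (Finsupp.mem_support_iff.2 h))
  have hβv : ∀ y, ∀ v ∉ B, β y v = 0 := fun y v hv => by
    by_contra h; exact hv (hβB y v (Finsupp.mem_support_iff.2 h))
  have hsupp : ∀ (w : WithLp 1 (E × F)) z, z ∈ (α w.fst + β w.snd).support → z ∈ A ∪ B := by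
    intro w z hz
    rcases Finset.mem_union.1 (Finsupp.support_add hz) with h | h
    · exact Or.inl (hαA _ z h)
    · exact Or.inr (hβB _ z h)
  have hchain : ∀ w : WithLp 1 (E × F),
      IsChain (· ≤ ·) ((α w.fst + β w.snd).support : Set P) := by
    intro w x hx y hy hxy
    rcases Finset.mem_union.1 (Finsupp.support_add hx) with h | h <;>
    rcases Finset.mem_union.1 (Finsupp.support_add hy) with h' | h'
    · exact hαch _ h h' hxy
    · exact Or.inl (hAB x (hαA _ x h) y (hβB _ y h')).le
    · exact Or.inr (hAB y (hαA _ y h') x (hβB _ x h)).le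
    · exact hβch _ h h' hxy
  have hsum : ∀ w : WithLp 1 (E × F), ((α w.fst + β w.snd).sum fun _ r => r) = ‖w‖ := fun w => by
    rw [Finsupp.sum_add_index' (fun _ => rfl) fun _ _ _ => rfl, hαsum, hβsum, hnorm]
  let G : sphere (0 : WithLp 1 (E × F)) 1 →
      {x : (orderComplex P).Realization | ∀ z ∈ x.coords.support, z ∈ A ∪ B} := fun w =>
    ⟨ofFinsupp (α w.1.fst + β w.1.snd) (fun v => add_nonneg (hα0 _ v) (hβ0 _ v))
      ⟨by
        rw [Finsupp.support_nonempty_iff]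
        intro h
        have := hsum w.1
        rw [h, mem_sphere_zero_iff_norm.1 w.2] at this
        simp at this, hchain w.1⟩
      (by rw [hsum, mem_sphere_zero_iff_norm.1 w.2]), hsupp w.1⟩
  have hG : Continuous G := by
    refine Continuous.subtype_mk (continuous_of_continuous_coords (hA.union hB).toFinset ?_ ?_) _
    · intro w z hz
      rw [Finite.mem_toFinset]
      exact hsupp w.1 z hz
    · intro v _
      exact ((hαc v).comp ((WithLp.continuous_fst 1 _ _).comp continuous_subtype_val)).add
        ((hβc v).comp ((WithLp.continuous_snd 1 _ _).comp continuous_subtype_val))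
  have hbij : Function.Bijective G := by
    constructor
    · intro w w' h
      have hc : ∀ v, α w.1.fst v + β w.1.snd v = α w'.1.fst v + β w'.1.snd v := fun v =>
        DFunLike.congr_fun (congrArg (fun x => x.1.coords) h) v
      have h1 : α w.1.fst = α w'.1.fst := by
        ext v
        by_cases hv : v ∈ A
        · have := hc v
          rwa [hβv _ v (hdisj v hv), hβv _ v (hdisj v hv), add_zero, add_zero] at this
        · rw [hαv _ v hv, hαv _ v hv]
      have h2 : β w.1.snd = β w'.1.snd := by
        ext v
        have := hc v
        rwa [h1, add_right_inj] at this
      refine Subtype.ext ?_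
      rw [WithLp.ext_iff]
      exact Prod.ext (hαinj h1) (hβinj h2)
    · rintro ⟨x, hx⟩
      have hch := x.support_coords_mem.2
      have hfilter : ∀ (p : P → Prop) [DecidablePred p],
          (∀ v, 0 ≤ x.coords.filter p v) ∧ (∀ z ∈ (x.coords.filter p).support, p z) ∧
          (∀ z ∈ (x.coords.filter p).support, z ∈ A ∪ B) ∧
          IsChain (· ≤ ·) ((x.coords.filter p).support : Set P) := by
        intro p _
        refine ⟨fun v => ?_, fun z hz => ?_, fun z hz => ?_, hch.mono ?_⟩
        · rw [Finsupp.filter_apply]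
          split_ifs
          · exact x.coords_nonneg v
          · exact le_rfl
        · rw [Finsupp.support_filter, Finset.mem_filter] at hz
          exact hz.2
        · rw [Finsupp.support_filter, Finset.mem_filter] at hz
          exact hx z hz.1
        · rw [Finsupp.support_filter]
          exact Finset.coe_subset.2 (Finset.filter_subset _ _)
      obtain ⟨hp0, hpA, -, hpch⟩ := hfilter (· ∈ A)
      obtain ⟨hq0, hqA, hqB, hqch⟩ := hfilter (fun v => ¬ v ∈ A)
      obtain ⟨y, hy⟩ := hαsurj _ hp0 hpA hpch
      obtain ⟨z, hz⟩ := hβsurj _ hq0 (fun v hv => (hqB v hv).resolve_left (hqA v hv)) hqch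
      have hyz : α y + β z = x.coords := by rw [hy, hz, Finsupp.filter_add_filter_not]
      let w : WithLp 1 (E × F) := WithLp.toLp 1 (y, z)
      have hw : ‖w‖ = 1 := by
        rw [← hsum]
        change ((α y + β z).sum fun _ r => r) = 1
        rw [hyz]
        exact x.sum_coords
      exact ⟨⟨w, mem_sphere_zero_iff_norm.2 hw⟩, Subtype.ext (coords_injective hyz)⟩
  have hcompact : CompactSpace (sphere (0 : WithLp 1 (E × F)) 1) := by
    have : ProperSpace (WithLp 1 (E × F)) := FiniteDimensional.proper ℝ _
    exact isCompact_iff_compactSpace.1 (isCompact_sphere _ _)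
  exact ⟨Continuous.homeoOfEquivCompactToT2 (f := Equiv.ofBijective G hbij) hG⟩

lemma nonempty_homeomorph_sphere_prod (E F : Type) [NormedAddCommGroup E] [NormedSpace ℝ E]
    [FiniteDimensional ℝ E] [NormedAddCommGroup F] [NormedSpace ℝ F] [FiniteDimensional ℝ F] :
    Nonempty (sphere (0 : WithLp 1 (E × F)) 1 ≃ₜ
      sphere (0 : EuclideanSpace ℝ (Fin (Module.finrank ℝ E + Module.finrank ℝ F))) 1) := by
  have L : WithLp 1 (E × F) ≃L[ℝ]
      EuclideanSpace ℝ (Fin (Module.finrank ℝ E + Module.finrank ℝ F)) :=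
    ContinuousLinearEquiv.ofFinrankEq (by
      rw [finrank_euclideanSpace_fin, (WithLp.linearEquiv 1 ℝ _).finrank_eq, Module.finrank_prod])
  exact ⟨L.unitSphereHomeomorph⟩

/-- The order complex of an ordinal sum of two posets is the join of their order complexes, so it
is a sphere if both are. -/
theorem isHomeomorphicToSphere_orderComplex_union {P : Type u} [PartialOrder P] {A B : Set P}
    (hA : A.Finite) (hB : B.Finite) (hAB : ∀ a ∈ A, ∀ b ∈ B, a < b)
    (hSA : IsHomeomorphicToSphere (orderComplex A).Realization)
    (hSB : IsHomeomorphicToSphere (orderComplex B).Realization) :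
    IsHomeomorphicToSphere (orderComplex ↥(A ∪ B)).Realization := by
  obtain ⟨a, ⟨φ⟩⟩ := hSA
  obtain ⟨b, ⟨ψ⟩⟩ := hSB
  obtain ⟨eA⟩ := nonempty_homeomorph_orderComplex_subset hA
  obtain ⟨eB⟩ := nonempty_homeomorph_orderComplex_subset hB
  obtain ⟨eS⟩ := nonempty_homeomorph_orderComplex_subset (hA.union hB)
  obtain ⟨α, hαc, hα0, hαA, hαch, hαsum, hαinj, hαsurj⟩ :=
    exists_radial_extension (eA.symm.trans φ)
  obtain ⟨β, hβc, hβ0, hβB, hβch, hβsum, hβinj, hβsurj⟩ :=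
    exists_radial_extension (eB.symm.trans ψ)
  obtain ⟨h⟩ := nonempty_homeomorph_join hA hB hAB hαc hα0 hαA hαch hαsum hαinj hαsurj
    hβc hβ0 hβB hβch hβsum hβinj hβsurj
  obtain ⟨L⟩ := nonempty_homeomorph_sphere_prod (EuclideanSpace ℝ (Fin a))
    (EuclideanSpace ℝ (Fin b))
  exact ⟨_, ⟨(eS.trans h.symm).trans L⟩⟩

end Join

section Link

open Set PreAbstractSimplicialComplex PreAbstractSimplicialComplex.Realization

variable {P : Type u} [PartialOrder P]

/-- The elements of `S` that are comparable to all elements of `σ` but do not belong to it; if `σ`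
is a chain of `S`, they are the vertices of its link in the order complex. -/
def linkSet (S σ : Set P) : Set P := {z ∈ S | ∀ c ∈ σ, z < c ∨ c < z}

lemma linkSet_subset (S σ : Set P) : linkSet S σ ⊆ S := sep_subset _ _

lemma linkSet_union (S σ τ : Set P) : linkSet S (σ ∪ τ) = linkSet (linkSet S σ) τ := by
  ext z
  constructor
  · exact fun h => ⟨⟨h.1, fun c hc => h.2 c (Or.inl hc)⟩, fun c hc => h.2 c (Or.inr hc)⟩
  · exact fun h => ⟨h.1.1, fun c hc => hc.elim (h.1.2 c) (h.2 c)⟩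

lemma linkSet_empty (S : Set P) : linkSet S ∅ = S := by
  simp [linkSet]

/-- The link of a chain in an order complex is the order complex of the elements comparable to
it. -/
lemma nonempty_homeomorph_link {S : Set P} (hS : S.Finite) {σ : Finset S}
    (hσ : σ ∈ (orderComplex S).faces) :
    Nonempty ((orderComplex ↥(linkSet S (Subtype.val '' (σ : Set S)))).Realization ≃ₜ
      ((orderComplex S).link σ).Realization) := by
  classical
  set T := linkSet S (Subtype.val '' (σ : Set S)) with hT
  have : Finite T := hS.subset (linkSet_subset _ _)
  let e : T ↪o S := Subtype.orderEmbedding (linkSet_subset _ _)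
  have hmem : ∀ z : S, z.1 ∈ T ↔ ∀ c ∈ σ, z < c ∨ c < z := fun z =>
    ⟨fun h c hc => h.2 c.1 ⟨c, hc, rfl⟩, fun h => ⟨z.2, by rintro _ ⟨c, hc, rfl⟩; exact h c hc⟩⟩
  obtain ⟨h⟩ := nonempty_homeomorph_support_subset ((orderComplex S).link σ) (orderComplex T)
    e.toEmbedding (fun τ => by
      constructor
      · rintro ⟨hne, hch⟩
        have hd : Disjoint σ (τ.map e.toEmbedding) := by
          rw [Finset.disjoint_left]
          intro z hz hzτ
          obtain ⟨w, -, rfl⟩ := Finset.mem_map.1 hzτ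
          rcases (hmem (e w)).1 w.2 _ hz with h | h <;> exact lt_irrefl _ h
        refine ⟨by simpa using hne, hd, ⟨hσ.1.mono fun z hz =>
          Finset.mem_disjUnion.2 (Or.inl hz), ?_⟩⟩
        have hcross : ∀ x ∈ σ, ∀ y ∈ τ.map e.toEmbedding, x ≤ y ∨ y ≤ x := by
          intro x hx y hy
          obtain ⟨w, -, rfl⟩ := Finset.mem_map.1 hy
          exact ((hmem (e w)).1 w.2 x hx).symm.imp le_of_lt le_of_lt
        intro x hx y hy hxy
        rcases Finset.mem_disjUnion.1 hx with hx | hx <;>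
        rcases Finset.mem_disjUnion.1 hy with hy | hy
        · exact hσ.2 hx hy hxy
        · exact hcross x hx y hy
        · exact (hcross y hy x hx).symm
        · exact (isChain_map_iff e τ).2 hch hx hy hxy
      · rintro ⟨hne, hd, -, hch⟩
        refine ⟨by simpa using hne, (isChain_map_iff e τ).1 (hch.mono fun z hz => ?_)⟩
        exact Finset.mem_disjUnion.2 (Or.inr hz))
  refine ⟨h.trans ((Homeomorph.setCongr ?_).trans (Homeomorph.Set.univ _))⟩
  refine eq_univ_of_forall fun x => ?_
  obtain ⟨hne, hd, -, hch⟩ := x.support_coords_mem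
  intro z hz
  have hzT : z.1 ∈ T := (hmem z).2 fun c hc => by
    have hzc : z ≠ c := fun h => Finset.disjoint_left.1 hd hc (h ▸ hz)
    rcases hch (Finset.mem_disjUnion.2 (Or.inr hz)) (Finset.mem_disjUnion.2 (Or.inl hc)) hzc
      with h | h
    · exact Or.inl (lt_of_le_of_ne h hzc)
    · exact Or.inr (lt_of_le_of_ne h hzc.symm)
  exact ⟨⟨z.1, hzT⟩, rfl⟩

lemma nonempty_homeomorph_orderComplex_of_orderIso {V W : Type u} [PartialOrder V] [PartialOrder W]
    [Finite W] (e : W ≃o V) :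
    Nonempty ((orderComplex W).Realization ≃ₜ (orderComplex V).Realization) := by
  obtain ⟨h⟩ := nonempty_homeomorph_support_subset (orderComplex V) (orderComplex W)
    e.toOrderEmbedding.toEmbedding fun τ =>
      and_congr (by simp) (isChain_map_iff e.toOrderEmbedding τ).symm
  refine ⟨h.trans ((Homeomorph.setCongr ?_).trans (Homeomorph.Set.univ _))⟩
  exact eq_univ_of_forall fun x z _ => e.surjective z

end Link

/-! ### Spheres of intervals in cell posets -/

section Intervals

open Set PreAbstractSimplicialComplex PreAbstractSimplicialComplex.Realization

lemma IsHomeomorphicToSphere.isTopologicalManifold {X : Type u} [TopologicalSpace X]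
    (hX : IsHomeomorphicToSphere X) : IsTopologicalManifold X := by
  obtain ⟨n, ⟨e⟩⟩ := hX
  refine ⟨e.symm.t2Space, e.isInducing.secondCountableTopology, ?_⟩
  cases n with
  | zero =>
    -- The empty space has an empty atlas.
    have : IsEmpty X := ⟨fun x => by
      have := (e x).2
      rw [Subsingleton.elim (e x).1 0] at this
      simp at this⟩
    exact ⟨0, ⟨{
      atlas := ∅
      chartAt := fun x => isEmptyElim x
      mem_chart_source := fun x => isEmptyElim x
      chart_mem_atlas := fun x => isEmptyElim x }⟩⟩
  | succ m =>
    have : Fact (Module.finrank ℝ (EuclideanSpace ℝ (Fin (m + 1))) = m + 1) :=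
      ⟨finrank_euclideanSpace_fin⟩
    let _ : ChartedSpace (Metric.sphere (0 : EuclideanSpace ℝ (Fin (m + 1))) 1) X :=
      e.toOpenPartialHomeomorph.singletonChartedSpace rfl
    exact ⟨m, ⟨ChartedSpace.comp _ (Metric.sphere (0 : EuclideanSpace ℝ (Fin (m + 1))) 1) X⟩⟩

variable {P : Type u} [PartialOrder P]

/-- The sphere condition on links in an order complex, in terms of the sets `linkSet S σ`; the
empty chain accounts for the condition that the whole complex is a sphere. -/
lemma isPLTriangulatedSphere_orderComplex_iff {S : Set P} (hS : S.Finite) :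
    IsPLTriangulatedSphere (orderComplex S) ↔
      ∀ σ : Finset P, (σ : Set P) ⊆ S → IsChain (· ≤ ·) (σ : Set P) →
        IsHomeomorphicToSphere (orderComplex ↥(linkSet S σ)).Realization := by
  classical
  constructor
  · rintro ⟨⟨-, hlink⟩, hsph⟩ σ hσS hσ
    rcases σ.eq_empty_or_nonempty with rfl | hne
    · rw [Finset.coe_empty, linkSet_empty]
      exact hsph
    · have hmap : Subtype.val '' ((σ.subtype (· ∈ S) : Finset S) : Set S) = (σ : Set P) := by
        ext z
        simp only [mem_image, Finset.mem_coe, Finset.mem_subtype]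
        exact ⟨by rintro ⟨y, hy, rfl⟩; exact hy, fun h => ⟨⟨z, hσS h⟩, h, rfl⟩⟩
      have hface : σ.subtype (· ∈ S) ∈ (orderComplex S).faces := by
        refine ⟨?_, fun x hx y hy hxy => ?_⟩
        · obtain ⟨z, hz⟩ := hne
          exact ⟨⟨z, hσS hz⟩, Finset.mem_subtype.2 hz⟩
        · exact hσ (Finset.mem_subtype.1 hx) (Finset.mem_subtype.1 hy)
            fun h => hxy (Subtype.ext h)
      obtain ⟨h⟩ := nonempty_homeomorph_link hS hface
      rw [hmap] at h
      exact (hlink _ hface).of_homeomorph h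
  · intro H
    have hsph : IsHomeomorphicToSphere (orderComplex S).Realization := by
      have := H ∅ (by simp) (by simp)
      rwa [Finset.coe_empty, linkSet_empty] at this
    refine ⟨⟨hsph.isTopologicalManifold, fun σ hσ => ?_⟩, hsph⟩
    obtain ⟨h⟩ := nonempty_homeomorph_link hS hσ
    have := H (σ.map (Function.Embedding.subtype _)) (by
      intro z hz
      obtain ⟨y, -, rfl⟩ := Finset.mem_map.1 hz
      exact y.2) ((isChain_map_iff (OrderEmbedding.subtype (· ∈ S)) σ).2 hσ.2)
    rw [Finset.coe_map] at this
    exact this.of_homeomorph h.symm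

/-- The link of a chain below `x` is the iterated join of the intervals between consecutive
elements. -/
lemma IsCellPoset.isHomeomorphicToSphere_linkSet_Iio (hP : IsCellPoset P)
    (h : ∀ x y : P, IsHomeomorphicToSphere (orderComplex (Ioo x y)).Realization) (x : P)
    (σ : Finset P) (hσx : ∀ c ∈ σ, c < x) (hσ : IsChain (· ≤ ·) (σ : Set P)) :
    IsHomeomorphicToSphere (orderComplex ↥(linkSet (Iio x) σ)).Realization := by
  classical
  induction hn : σ.card generalizing x σ with
  | zero =>
    rw [Finset.card_eq_zero] at hn
    rw [hn, Finset.coe_empty, linkSet_empty]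
    exact hP.isHomeomorphicToSphere_Iio x
  | succ n ih =>
    have hne : σ.Nonempty := Finset.card_pos.1 (by omega)
    obtain ⟨c, hc, hmax⟩ := exists_greatest_of_mem_faces (Q := P) ⟨hne, hσ⟩
    have hlt : ∀ d ∈ σ.erase c, d < c := fun d hd =>
      lt_of_le_of_ne (hmax d (Finset.mem_of_mem_erase hd)) (Finset.ne_of_mem_erase hd)
    have heq : linkSet (Iio x) (σ : Set P) =
        linkSet (Iio c) ((σ.erase c : Finset P) : Set P) ∪ Ioo c x := by
      ext z
      constructor
      · rintro ⟨hzx, hz⟩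
        rcases hz c hc with hzc | hcz
        · exact Or.inl ⟨hzc, fun d hd => hz d (Finset.mem_of_mem_erase hd)⟩
        · exact Or.inr ⟨hcz, hzx⟩
      · rintro (⟨hzc, hz⟩ | ⟨hcz, hzx⟩)
        · refine ⟨lt_trans hzc (hσx c hc), fun d hd => ?_⟩
          by_cases hdc : d = c
          · exact Or.inl (hdc ▸ hzc)
          · exact hz d (Finset.mem_erase.2 ⟨hdc, hd⟩)
        · exact ⟨hzx, fun d hd => Or.inr ((hmax d hd).trans_lt hcz)⟩
    rw [heq]
    refine isHomeomorphicToSphere_orderComplex_union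
      ((hP.finite_Iio c).subset (linkSet_subset _ _)) ((hP.finite_Iio x).subset fun z hz => hz.2)
      (fun a ha b hb => lt_trans ha.1 hb.1) ?_ (h c x)
    refine ih c _ hlt (hσ.mono (Finset.coe_subset.2 (Finset.erase_subset _ _))) ?_
    rw [Finset.card_erase_of_mem hc, hn, Nat.add_sub_cancel]

/-- If `x` is the largest element of a maximal chain among the elements `≤ x`, then the link of the
chain in `Iio y` is the interval between `x` and `y`. -/
lemma exists_linkSet_Iio_eq_Ioo {x : P} (y : P) (hfin : (Iio x).Finite) :
    ∃ σ : Finset P, (∀ c ∈ σ, c ≤ x) ∧ IsChain (· ≤ ·) (σ : Set P) ∧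
      linkSet (Iio y) σ = Ioo x y := by
  classical
  have hIic : (Iic x).Finite := by
    rw [← Iio_insert]
    exact hfin.insert x
  let C : Set (Finset P) := {σ | x ∈ σ ∧ (∀ c ∈ σ, c ≤ x) ∧ IsChain (· ≤ ·) (σ : Set P)}
  have hC : C.Finite := by
    refine (hIic.toFinset.powerset.finite_toSet).subset fun σ hσ => ?_
    rw [Finset.mem_coe, Finset.mem_powerset]
    intro c hc
    rw [Finite.mem_toFinset]
    exact hσ.2.1 c hc
  obtain ⟨σ, hσ⟩ := hC.exists_maximal ⟨{x}, by simp, by simp, by simp⟩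
  obtain ⟨hxσ, hle, hch⟩ := hσ.prop
  refine ⟨σ, hle, hch, ?_⟩
  ext z
  constructor
  · rintro ⟨hzy, hz⟩
    refine ⟨(hz x hxσ).resolve_left fun hzx => ?_, hzy⟩
    -- otherwise `z` could be added to the chain
    have hins : insert z σ ∈ C := by
      refine ⟨Finset.mem_insert_of_mem hxσ, fun c hc => ?_, ?_⟩
      · rcases Finset.mem_insert.1 hc with rfl | hc
        · exact le_of_lt hzx
        · exact hle c hc
      · rw [Finset.coe_insert]
        exact hch.insert fun c hc _ => (hz c hc).imp le_of_lt le_of_lt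
    have hzσ : z ∈ σ := hσ.le_of_ge hins (Finset.subset_insert z σ) (Finset.mem_insert_self z σ)
    rcases hz z hzσ with h | h <;> exact lt_irrefl z h
  · rintro ⟨hxz, hzy⟩
    exact ⟨hzy, fun c hc => Or.inr ((hle c hc).trans_lt hxz)⟩

lemma isHomeomorphicToSphere_of_isEmpty {X : Type u} [TopologicalSpace X] [IsEmpty X] :
    IsHomeomorphicToSphere X := by
  have : IsEmpty (Metric.sphere (0 : EuclideanSpace ℝ (Fin 0)) 1) := ⟨fun x => by
    have := x.2
    rw [Subsingleton.elim x.1 0] at this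
    simp at this⟩
  exact ⟨0, ⟨Homeomorph.empty⟩⟩

lemma nonempty_orderIso_Iio_Ioi {x : P} (y : Ioi x) : Nonempty (Iio y ≃o Ioo x y.1) :=
  ⟨{ toFun := fun z => ⟨z.1.1, z.1.2, z.2⟩
     invFun := fun z => ⟨⟨z.1, z.2.1⟩, z.2.2⟩
     left_inv := fun _ => rfl
     right_inv := fun _ => rfl
     map_rel_iff' := Iff.rfl }⟩

end Intervals

theorem mainTheorem7 {P : Type u} [PartialOrder P] (hP : IsCellPoset P) :
    List.TFAE [
      ∀ x : P, IsPLTriangulatedSphere (orderComplex (Set.Iio x)),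
      ∀ x y : P, IsPLTriangulatedSphere (orderComplex (Set.Ioo x y)),
      ∀ x y : P, IsHomeomorphicToSphere (orderComplex (Set.Ioo x y)).Realization,
      ∀ x : P, IsCellPoset (Set.Ioi x)] := by
  have hfin : ∀ x y : P, (Set.Ioo x y).Finite := fun x y =>
    (hP.finite_Iio y).subset fun z hz => hz.2
  have hempty : ∀ x y : P, ¬ x < y →
      IsHomeomorphicToSphere (orderComplex (Set.Ioo x y)).Realization := fun x y hxy => by
    have : IsEmpty (orderComplex (Set.Ioo x y)).Realization := ⟨fun p => by
      obtain ⟨z, -⟩ := p.support_coords_mem.1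
      exact hxy (z.2.1.trans z.2.2)⟩
    exact isHomeomorphicToSphere_of_isEmpty
  have hiso : ∀ (x : P) (y : Set.Ioi x), Nonempty ((orderComplex (Set.Iio y)).Realization ≃ₜ
      (orderComplex (Set.Ioo x y.1)).Realization) := fun x y => by
    obtain ⟨e⟩ := nonempty_orderIso_Iio_Ioi y
    have : Finite (Set.Ioo x y.1) := hfin x y
    have : Finite (Set.Iio y) := Finite.of_equiv _ e.symm.toEquiv
    exact nonempty_homeomorph_orderComplex_of_orderIso e
  tfae_have 1 → 2 := by
    classical
    intro h x y
    rw [isPLTriangulatedSphere_orderComplex_iff (hfin x y)]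
    intro τ hτ hτch
    by_cases hxy : x < y
    · obtain ⟨σ, hσx, hσch, hσ⟩ := exists_linkSet_Iio_eq_Ioo y (hP.finite_Iio x)
      have := (isPLTriangulatedSphere_orderComplex_iff (hP.finite_Iio y)).1 (h y) (σ ∪ τ)
        (fun z hz => by
          rcases Finset.mem_union.1 hz with hz | hz
          · exact (hσx z hz).trans_lt hxy
          · exact (hτ hz).2)
        (by
          have hcross : ∀ a ∈ σ, ∀ b ∈ τ, a ≤ b := fun a ha b hb =>
            (hσx a ha).trans (hτ hb).1.le
          intro a ha b hb hab
          rcases Finset.mem_union.1 ha with ha | ha <;>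
          rcases Finset.mem_union.1 hb with hb | hb
          · exact hσch ha hb hab
          · exact Or.inl (hcross a ha b hb)
          · exact Or.inr (hcross b hb a ha)
          · exact hτch ha hb hab)
      rwa [Finset.coe_union, linkSet_union, hσ] at this
    · have : τ = ∅ := Finset.eq_empty_of_forall_notMem fun z hz =>
        hxy ((hτ hz).1.trans (hτ hz).2)
      rw [this, Finset.coe_empty, linkSet_empty]
      exact hempty x y hxy
  tfae_have 2 → 3 := fun h x y => (h x y).2
  tfae_have 3 → 1 := fun h x =>
    (isPLTriangulatedSphere_orderComplex_iff (hP.finite_Iio x)).2 fun σ hσx hσ =>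
      hP.isHomeomorphicToSphere_linkSet_Iio h x σ (fun _ hc => hσx hc) hσ
  tfae_have 3 → 4 := fun h x => by
    refine isCellPoset_of_isHomeomorphicToSphere_Iio (fun y => ?_) fun y => ?_
    · obtain ⟨e⟩ := nonempty_orderIso_Iio_Ioi y
      have : Finite (Set.Ioo x y.1) := hfin x y
      exact Finite.of_equiv _ e.symm.toEquiv
    · obtain ⟨e⟩ := hiso x y
      exact (h x y).of_homeomorph e
  tfae_have 4 → 3 := fun h x y => by
    by_cases hxy : x < y
    · obtain ⟨e⟩ := hiso x ⟨y, hxy⟩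
      exact ((h x).isHomeomorphicToSphere_Iio ⟨y, hxy⟩).of_homeomorph e.symm
    · exact hempty x y hxy
  tfae_finish
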